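/- Let $m\ge 2$ and let $f:(S^1)^m\to\mathbb R\cup\{-\infty\}$ be a function on $m$-tuples of points of the unit circle satisfying the following Conditions A. (A1) $f$ is invariant under rotations: $f(U_1,\dots,U_m)=h(\beta_1,\dots,\beta_{m-1})$, where $\beta_i\in[0,2\pi)$ is the counterclockwise angle from $U_1$ to $U_{i+1}$ and $h:[0,2\pi)^{m-1}\to\mathbb R\cup\{-\infty\}$. (A2) $f$ is invariant under all permutations of its $m$ arguments. (A3) $h$ is continuous and extends continuously to a function $h:[0,2\pi]^{m-1}\to\mathbb R\cup\{-\infty\}$. (A4) $h$ attains its maximal value $M$ on $[0,2\pi]^{m-1}$ at only finitely many points, and all of them lie in $(0,2\pi)^{m-1}$. (A5) There is $\delta>0$ such that $h$ is finite and three times continuously differentiable in the $\delta$-neighbourhood of every maximum point. (A6) The Hessian matrix of $h$ at every maximum point has nonzero determinant. Let $U_1,U_2,\dots$ be random points of $S^1$ satisfying the following Conditions B. (B1) $U_1,U_2,\dots$ are independent and have the same probability density $p$ with respect to the angle. (B2) $p$ is continuous, i.e. it is a nonnegative continuous $2\pi$-periodic function $p:\mathbb R\to[0,\infty)$ with $\int_0^{2\pi}p(x)\,dx=1$.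 (B3) There is a maximum point $V=(V^1,\dots,V^{m-1})$ of $h$ with $\int_0^{2\pi}p(x)\prod_{l=1}^{m-1}p(x+V^l)\,dx\neq 0$. For $n\ge m$ let $H_n=\max_{1\le i_1<\dots<i_m\le n}f(U_{i_1},\dots,U_{i_m})$. Let $W_1,\dots,W_r$ be those maximum points $W_i=(W_i^1,\dots,W_i^{m-1})$ of $h$ whose angles are in ascending order, $W_i^1\le\dots\le W_i^{m-1}$, and let $G_i$ be the Hessian matrix of $h$ at $W_i$. Then for every $t>0$ $$\lim_{n\to\infty}\mathbb P\Bigl\{n^{\frac{2m}{m-1}}(M-H_n)\le t\Bigr\}=1-\exp\Bigl(-\frac{t^{\frac{m-1}{2}}K}{m}\Bigr),$$ where $$K=\frac{(2\pi)^{\frac{m-1}{2}}}{\Gamma\left(\frac{m+1}{2}\right)}\sum_{i=1}^r\frac{1}{\sqrt{\det(-G_i)}}\int_0^{2\pi}p(x)\prod_{l=1}^{m-1}p(x+W_i^l)\,dx .$$ -/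

import Mathlib

open MeasureTheory ProbabilityTheory Filter Topology

noncomputable section

/-- The closed cube `[0, 2π]^d`. A kernel of degree `m = d + 1` on the circle is described by
`d = m - 1` central angles. -/
def angleCube (d : ℕ) : Set (Fin d → ℝ) :=
  Set.univ.pi fun _ => Set.Icc 0 (2 * Real.pi)

/-- The points `β ∈ [0, 2π]^d` at which `h` takes the value `M`. -/
def maxPoints {d : ℕ} (h : (Fin d → ℝ) → EReal) (M : ℝ) : Set (Fin d → ℝ) :=
  {β | β ∈ angleCube d ∧ h β = (M : EReal)}

/-- The points `β ∈ [0, 2π]^d` with `h β = M` whose angles are in ascending order. -/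
def orderedMaxPoints {d : ℕ} (h : (Fin d → ℝ) → EReal) (M : ℝ) : Set (Fin d → ℝ) :=
  {β | β ∈ maxPoints h M ∧ Monotone β}

/-- The matrix of second partial derivatives `∂²g / ∂x_a ∂x_b` at the point `x`. -/
def hessianMatrix {d : ℕ} (g : (Fin d → ℝ) → ℝ) (x : Fin d → ℝ) : Matrix (Fin d) (Fin d) ℝ :=
  Matrix.of fun a b =>
    fderiv ℝ (fun y => fderiv ℝ g y (Pi.single b 1)) x (Pi.single a 1)

/-- The conditions on a kernel `f : (S¹)^(d+1) → ℝ ∪ {-∞}`. The value `-∞` is `⊥ : EReal`; the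
value `⊤` is excluded because `f` is bounded above by the real number `M`. Only the values of `h`
on the cube `[0, 2π]^d` matter: there `h` is the continuous extension to `[0, 2π]^d` of the
function on `[0, 2π)^d` that expresses `f` through the central angles. -/
structure KernelConditions {d : ℕ} (f : (Fin (d + 1) → Circle) → EReal)
    (h : (Fin d → ℝ) → EReal) (M : ℝ) : Prop where
  /-- `f` depends only on the central angles, measured counterclockwise from the first point. -/
  rotation_invariant : ∀ (u : Circle) (β : Fin d → ℝ), (∀ j, β j ∈ Set.Ico 0 (2 * Real.pi)) →
    f (Fin.cons u fun j => u * Circle.exp (β j)) = h β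
  /-- `f` does not change when its arguments are permuted. -/
  symmetric : ∀ (σ : Equiv.Perm (Fin (d + 1))) (x : Fin (d + 1) → Circle), f (x ∘ σ) = f x
  /-- `h` is continuous on the closed cube, as a function with values in `ℝ ∪ {-∞}`. -/
  continuous : ContinuousOn h (angleCube d)
  /-- `M` is the maximal value of `h`, and it is attained. -/
  max_value : IsGreatest (h '' angleCube d) (M : EReal)
  /-- There are finitely many maximum points. -/
  finite_maxPoints : (maxPoints h M).Finite
  /-- No maximum point lies on the boundary of the cube. -/
  maxPoints_interior : ∀ V ∈ maxPoints h M, ∀ j, V j ∈ Set.Ioo 0 (2 * Real.pi)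
  /-- `h` is finite and three times continuously differentiable near every maximum point. -/
  smooth : ∃ δ > 0, ∀ V ∈ maxPoints h M, (∀ x ∈ Metric.ball V δ, h x ≠ ⊥) ∧
    ContDiffOn ℝ 3 (fun x => (h x).toReal) (Metric.ball V δ)
  /-- The Hessian matrix is nonsingular at every maximum point. -/
  nondegenerate : ∀ V ∈ maxPoints h M, (hessianMatrix (fun x => (h x).toReal) V).det ≠ 0

/-- `p` is a continuous probability density on the circle, written as a `2π`-periodic function. -/
structure IsCircleDensity (p : ℝ → ℝ) : Prop where
  continuous : Continuous p
  nonneg : ∀ x, 0 ≤ p x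
  periodic : Function.Periodic p (2 * Real.pi)
  integral_eq_one : ∫ x in (0)..(2 * Real.pi), p x = 1

/-- The unit circle carries its Borel `σ`-algebra. -/
instance circleMeasurableSpace : MeasurableSpace Circle := borel Circle

instance circleBorelSpace : BorelSpace Circle := ⟨rfl⟩

/-- The distribution on the unit circle whose density with respect to the angle is `p`. -/
def circleLaw (p : ℝ → ℝ) : Measure Circle :=
  ((volume.restrict (Set.Ico 0 (2 * Real.pi))).withDensity
    fun x => ENNReal.ofReal (p x)).map (fun x : ℝ => Circle.exp x)

/-- The integral `∫₀^{2π} p(x) ∏_l p(x + V^l) dx`. -/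
def configIntegral {d : ℕ} (p : ℝ → ℝ) (V : Fin d → ℝ) : ℝ :=
  ∫ x in (0)..(2 * Real.pi), p x * ∏ l, p (x + V l)

/-- The conditions on the random points `U 0, U 1, …`: they are independent with the common
continuous density `p`, and `∫₀^{2π} p(x) ∏_l p(x + V^l) dx ≠ 0` for some maximum point `V`. -/
structure PointConditions {Ω : Type*} [MeasurableSpace Ω] (μ : Measure Ω) (U : ℕ → Ω → Circle)
    (p : ℝ → ℝ) {d : ℕ} (h : (Fin d → ℝ) → EReal) (M : ℝ) : Prop where
  density : IsCircleDensity p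
  measurable : ∀ i, Measurable (U i)
  independent : iIndepFun U μ
  law : ∀ i, μ.map (U i) = circleLaw p
  nonvanishing : ∃ V ∈ maxPoints h M, configIntegral p V ≠ 0

/-- The `U`-max statistic `H_n`: the maximum of `f (x_{i_1}, …, x_{i_m})` over all
`i_1 < … < i_m` among the first `n` indices (it is `⊥` if `n < m`). -/
def uMax {m : ℕ} (f : (Fin m → Circle) → EReal) (x : ℕ → Circle) (n : ℕ) : EReal :=
  ⨆ J : Fin m ↪o Fin n, f fun k => x (J k)

/-- The constant `K`, with `m - 1 = d`; the sum is over the maximum points with ordered angles. -/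
def limitConstant {d : ℕ} (p : ℝ → ℝ) (h : (Fin d → ℝ) → EReal) (M : ℝ) : ℝ :=
  (2 * Real.pi) ^ ((d : ℝ) / 2) / Real.Gamma (((d : ℝ) + 2) / 2) *
    ∑ᶠ W ∈ orderedMaxPoints h M,
      1 / Real.sqrt ((-hessianMatrix (fun x => (h x).toReal) W).det) * configIntegral p W

end

/-! ### Poisson approximation for dissociated events. -/

section PoissonApproximation

/-! Write `m = d + 1` and `s = t / n ^ (2m/d)`. The event in the limit says that some `m`-subtuple
of the first `n` points has kernel value at least `M - s`. The number of such subtuples is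
asymptotically Poisson, so the probability that there is none tends to `exp (-λ)`, where `λ` is the
limit of their expected number.

The expectation is found by Laplace's method. Rotation invariance reduces the probability for one
tuple to the integral of `configIntegral p` over `superlevel h M s` (`pi_circleLaw_relAngles`). For
small `s` this set is a union of near-ellipsoids of size `√s` around the maximum points, where `-h`
is quadratic up to lower order, so the integral is of order `s ^ (d/2)`, with the ellipsoid volumes
as constants (`tendsto_setIntegral_superlevel`, `tendsto_superlevel`). The exponent `2m/d` makes `s
^ (d/2)` cancel the `n ^ m` of the binomial coefficient. Each ordered maximum point stands for `d!`
maximum points, and `d!/m! = 1/m` gives the factor in the limit.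

The Poisson approximation compares the generating function `φ v = E v ^ S` of the count `S` with the
solution of `φ' = λ φ`, here with `λ` the exact mean. The error consists of `P(E_a) P(E_b)` and
`P(E_a ∩ E_b)` over overlapping tuples (`abs_measureReal_iInter_compl_sub_exp_le`). By permutation
symmetry, in a tuple that counts any two points have a central angle within `O(√s)` of a coordinate
of a maximum point, which given one point has probability at most `q = O(√s)`. Two overlapping
tuples covering `k` indices thus both count with probability at most `q ^ (k-1)`, and there are `O(n
^ k)` such pairs. The total error is `O(n (n q) ^ m)`. Since `n q = O(n ^ (-1/d))`, this is `O(n ^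
(-1/d))`. -/

lemma pow_sub_pow_add_le {v : ℝ} (h0 : 0 ≤ v) (h1 : v ≤ 1) (a b : ℕ) :
    |v ^ (a + b) - v ^ a| ≤ b := by
  rcases Nat.eq_zero_or_pos b with rfl | hb
  · simp
  · have h2 : v ^ a ≤ 1 := pow_le_one₀ h0 h1
    have h3 : v ^ (a + b) ≤ 1 := pow_le_one₀ h0 h1
    have h4 : 0 ≤ v ^ a := pow_nonneg h0 _
    have h5 : 0 ≤ v ^ (a + b) := pow_nonneg h0 _
    have h6 : (1 : ℝ) ≤ b := by exact_mod_cast hb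
    rw [abs_le]
    constructor <;> linarith

/-- A function that nearly solves `φ' = l φ`, `φ 1 = 1` on `[0, 1]` is close to `exp (-l)` at `0`. -/
lemma abs_sub_exp_neg_le {φ φ' : ℝ → ℝ} {l b : ℝ} (hl : 0 ≤ l)
    (hd : ∀ v ∈ Set.Icc (0 : ℝ) 1, HasDerivAt φ (φ' v) v)
    (hb : ∀ v ∈ Set.Icc (0 : ℝ) 1, |φ' v - l * φ v| ≤ b) (h1 : φ 1 = 1) :
    |φ 0 - Real.exp (-l)| ≤ b := by
  -- Integrating factor: `exp (-l v) φ v` has derivative `exp (-l v) (φ' v - l φ v)`, at most `b` in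
  -- absolute value, and its endpoint values are `φ 0` and `exp (-l)`.
  have key : ∀ v ∈ Set.Icc (0 : ℝ) 1, HasDerivWithinAt (fun v => Real.exp (-(l * v)) * φ v)
      (Real.exp (-(l * v)) * (φ' v - l * φ v)) (Set.Icc 0 1) v := by
    intro v hv
    have h := (((hasDerivAt_id v).const_mul l).neg.exp.mul (hd v hv)).hasDerivWithinAt
      (s := Set.Icc 0 1)
    refine h.congr_deriv ?_
    simp only [id, Pi.neg_apply]
    ring
  have h := (convex_Icc (0 : ℝ) 1).norm_image_sub_le_of_norm_hasDerivWithin_le (C := b) key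
    (fun v hv => by
      rw [norm_mul, Real.norm_eq_abs, Real.norm_eq_abs, Real.abs_exp]
      have h2 : Real.exp (-(l * v)) ≤ 1 := by
        rw [Real.exp_le_one_iff]
        have := mul_nonneg hl hv.1
        linarith
      calc _ ≤ 1 * |φ' v - l * φ v| := by gcongr
        _ ≤ b := by rw [one_mul]; exact hb v hv)
    (Set.right_mem_Icc.2 zero_le_one) (Set.left_mem_Icc.2 zero_le_one)
  simpa [h1] using h

variable {Ω ι : Type*} [MeasurableSpace Ω]

/-- Poisson approximation for a dissociated family: the probability that none of the events `E a`
occurs is close to `exp (-∑ a, P (E a))` when each `E a` is independent of the number of events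
outside its neighbourhood `B a`. -/
theorem abs_measureReal_iInter_compl_sub_exp_le [DecidableEq ι] (μ : Measure Ω)
    [IsProbabilityMeasure μ] (I : Finset ι) (E : ι → Set Ω) (hE : ∀ a, MeasurableSet (E a))
    (B : ι → Finset ι) (hBI : ∀ a ∈ I, B a ⊆ I) (hB : ∀ a ∈ I, a ∈ B a)
    (hind : ∀ a ∈ I, IndepFun ((E a).indicator (fun _ => (1 : ℕ)))
      (fun ω => ∑ b ∈ I \ B a, (E b).indicator (fun _ => (1 : ℕ)) ω) μ) :
    |μ.real (⋂ a ∈ I, (E a)ᶜ) - Real.exp (-∑ a ∈ I, μ.real (E a))| ≤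
      ∑ a ∈ I, ∑ b ∈ B a, μ.real (E a) * μ.real (E b) +
      ∑ a ∈ I, ∑ b ∈ (B a).erase a, μ.real (E a ∩ E b) := by
  set X : ι → Ω → ℕ := fun a => (E a).indicator (fun _ => (1 : ℕ)) with hX
  have hXm : ∀ a, Measurable (X a) := fun a => measurable_const.indicator (hE a)
  have hX1 : ∀ a ω, X a ω ≤ 1 := by
    intro a ω
    by_cases h : ω ∈ E a <;> simp [hX, h]
  set S : Finset ι → Ω → ℕ := fun J ω => ∑ b ∈ J, X b ω with hS
  have hSm : ∀ J, Measurable (S J) := fun J => Finset.measurable_sum J fun a _ => hXm a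
  have hSc : ∀ J ω, S J ω ≤ J.card := fun J ω =>
    (Finset.sum_le_card_nsmul J _ 1 fun a _ => hX1 a ω).trans (by simp)
  have hbint : ∀ g : Ω → ℝ, Measurable g → (∃ C, ∀ ω, |g ω| ≤ C) → Integrable g μ := by
    rintro g hg ⟨C, hC⟩
    exact Integrable.of_bound hg.aestronglyMeasurable C (ae_of_all _ hC)
  have hXint : ∀ a, ∫ ω, (X a ω : ℝ) ∂μ = μ.real (E a) := by
    intro a
    rw [← integral_indicator_one (hE a)]
    congr 1
    ext ω
    by_cases h : ω ∈ E a <;> simp [hX, h]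
  have hXXint : ∀ a b, ∫ ω, (X a ω : ℝ) * X b ω ∂μ = μ.real (E a ∩ E b) := by
    intro a b
    rw [← integral_indicator_one ((hE a).inter (hE b))]
    congr 1
    ext ω
    by_cases h : ω ∈ E a <;> by_cases h' : ω ∈ E b <;> simp [hX, h, h']
  have hXi : ∀ a, Integrable (fun ω => (X a ω : ℝ)) μ := fun a =>
    hbint _ (measurable_from_nat.comp (hXm a)) ⟨1, fun ω => by
      rw [abs_of_nonneg (by positivity)]; exact_mod_cast hX1 a ω⟩
  have hXXi : ∀ a b, Integrable (fun ω => (X a ω : ℝ) * X b ω) μ := fun a b =>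
    hbint _ ((measurable_from_nat.comp (hXm a)).mul (measurable_from_nat.comp (hXm b)))
      ⟨1, fun ω => by
        rw [abs_of_nonneg (by positivity)]
        exact_mod_cast Nat.mul_le_mul (hX1 a ω) (hX1 b ω)⟩
  have hpow1 : ∀ v ∈ Set.Icc (0 : ℝ) 1, ∀ k : ℕ, |v ^ k| ≤ 1 := fun v hv k => by
    rw [abs_of_nonneg (pow_nonneg hv.1 _)]; exact pow_le_one₀ hv.1 hv.2
  have hSi : ∀ v ∈ Set.Icc (0 : ℝ) 1, ∀ J, Integrable (fun ω => v ^ S J ω) μ := fun v hv J =>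
    hbint _ ((measurable_from_nat (f := fun k : ℕ => v ^ k)).comp (hSm J))
      ⟨1, fun ω => hpow1 v hv _⟩
  have hXSi : ∀ v ∈ Set.Icc (0 : ℝ) 1, ∀ a J, Integrable (fun ω => (X a ω : ℝ) * v ^ S J ω) μ :=
    fun v hv a J => hbint _ ((measurable_from_nat.comp (hXm a)).mul
      ((measurable_from_nat (f := fun k : ℕ => v ^ k)).comp (hSm J))) ⟨1, fun ω => by
        rw [abs_mul, abs_of_nonneg (by positivity : (0 : ℝ) ≤ X a ω)]
        have h1 : (X a ω : ℝ) ≤ 1 := by exact_mod_cast hX1 a ω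
        calc _ ≤ (1 : ℝ) * 1 := mul_le_mul h1 (hpow1 v hv _) (abs_nonneg _) zero_le_one
          _ = 1 := one_mul _⟩
  set l : ℝ := ∑ a ∈ I, μ.real (E a) with hl
  set φ : ℝ → ℝ := fun v => ∫ ω, v ^ S I ω ∂μ with hφ
  set φ' : ℝ → ℝ := fun v => ∫ ω, (S I ω : ℝ) * v ^ (S I ω - 1) ∂μ with hφ'
  have hderiv : ∀ v ∈ Set.Icc (0 : ℝ) 1, HasDerivAt φ (φ' v) v := by
    intro v hv
    -- On the unit ball around `v` one has `|w| ≤ 2`, and `S` is at most `I.card`; this gives a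
    -- constant dominating function.
    refine (hasDerivAt_integral_of_dominated_loc_of_deriv_le (μ := μ)
      (F := fun v ω => v ^ S I ω) (F' := fun v ω => (S I ω : ℝ) * v ^ (S I ω - 1))
      (bound := fun _ => (I.card : ℝ) * 2 ^ I.card) (Metric.ball_mem_nhds v one_pos)
      ?_ (hSi v hv I) ?_ ?_ (integrable_const _) ?_).2
    · exact .of_forall fun v =>
        ((measurable_from_nat (f := fun k : ℕ => v ^ k)).comp (hSm I)).aestronglyMeasurable
    · exact ((measurable_from_nat (f := fun k : ℕ => (k : ℝ) * v ^ (k - 1))).comp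
        (hSm I)).aestronglyMeasurable
    · refine ae_of_all _ fun ω w hw => ?_
      have hw2 : |w| ≤ 2 := by
        rw [Metric.mem_ball, Real.dist_eq, abs_lt] at hw
        rw [abs_le]; constructor <;> linarith [hv.1, hv.2, hw.1, hw.2]
      rw [norm_mul, norm_pow, Real.norm_eq_abs, Real.norm_eq_abs, Nat.abs_cast]
      have h1 : (S I ω : ℝ) ≤ I.card := by exact_mod_cast hSc I ω
      have h2 : |w| ^ (S I ω - 1) ≤ 2 ^ I.card :=
        (pow_le_pow_left₀ (abs_nonneg _) hw2 _).trans
          (pow_le_pow_right₀ one_le_two ((Nat.sub_le _ _).trans (hSc I ω)))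
      exact mul_le_mul h1 h2 (by positivity) (by positivity)
    · exact ae_of_all _ fun ω w _ => hasDerivAt_pow _ _
  have hφ1 : φ 1 = 1 := by simp [hφ]
  -- Since `0 ^ 0 = 1`, the variable `0 ^ S` is the indicator of `S = 0`.
  have hφ0 : φ 0 = μ.real (⋂ a ∈ I, (E a)ᶜ) := by
    rw [← integral_indicator_one (I.measurableSet_biInter fun a _ => (hE a).compl)]
    refine integral_congr_ae (ae_of_all _ fun ω => ?_)
    change (0 : ℝ) ^ S I ω = _
    by_cases h : ω ∈ ⋂ a ∈ I, (E a)ᶜ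
    · have h0 : S I ω = 0 := Finset.sum_eq_zero fun a ha => by
        have := Set.mem_iInter₂.1 h a ha
        simpa [hX] using this
      rw [h0, Set.indicator_of_mem h]
      simp
    · rw [Set.indicator_of_notMem h]
      refine zero_pow fun h0 => h (Set.mem_iInter₂.2 fun a ha => ?_)
      have := Finset.sum_eq_zero_iff.1 h0 a ha
      intro hmem
      simp [hX, hmem] at this
  -- The heart of the estimate: deleting the neighbours of `a` from the exponent makes it
  -- independent of `X a`; putting them all back afterwards yields `φ v`. By `pow_sub_pow_add_le`
  -- each change costs at most the number of events deleted or restored.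
  have hcompare : ∀ v ∈ Set.Icc (0 : ℝ) 1, ∀ a ∈ I,
      |∫ ω, (X a ω : ℝ) * v ^ (S I ω - 1) ∂μ - μ.real (E a) * φ v| ≤
        ∑ b ∈ B a, μ.real (E a) * μ.real (E b) +
          ∑ b ∈ (B a).erase a, μ.real (E a ∩ E b) := by
    intro v hv a ha
    have hsplit : ∀ ω, S I ω = S (I \ B a) ω + S (B a) ω := fun ω =>
      (Finset.sum_sdiff (hBI a ha)).symm
    have hsplit' : ∀ ω, S (B a) ω = S ((B a).erase a) ω + X a ω := fun ω =>
      (Finset.sum_erase_add _ _ (hB a ha)).symm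
    have hprod : ∫ ω, (X a ω : ℝ) * v ^ S (I \ B a) ω ∂μ =
        μ.real (E a) * ∫ ω, v ^ S (I \ B a) ω ∂μ := by
      rw [← hXint a]
      have : IndepFun (fun ω => (X a ω : ℝ)) (fun ω => v ^ S (I \ B a) ω) μ :=
        (hind a ha).comp (φ := fun k : ℕ => (k : ℝ)) (ψ := fun k : ℕ => v ^ k)
          measurable_from_nat measurable_from_nat
      exact this.integral_fun_mul_eq_mul_integral
        (measurable_from_nat.comp (hXm a)).aestronglyMeasurable
        ((measurable_from_nat (f := fun k : ℕ => v ^ k)).comp (hSm _)).aestronglyMeasurable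
    -- Truncated subtraction does no harm: if `X a = 0` both sides vanish, and if `X a = 1` then `S
    -- I ≥ 1`.
    have hpt : ∀ ω, (X a ω : ℝ) * v ^ (S I ω - 1) =
        X a ω * v ^ (S (I \ B a) ω + S ((B a).erase a) ω) := by
      intro ω
      rcases Nat.le_one_iff_eq_zero_or_eq_one.1 (hX1 a ω) with h0 | h1
      · simp [h0]
      · rw [hsplit, hsplit', h1, ← add_assoc, Nat.add_sub_cancel]
    have hi1 : Integrable (fun ω => (X a ω : ℝ) * v ^ (S I ω - 1)) μ := by
      refine hbint _ ((measurable_from_nat.comp (hXm a)).mul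
        ((measurable_from_nat (f := fun k : ℕ => v ^ (k - 1))).comp (hSm I))) ⟨1, fun ω => ?_⟩
      rw [abs_mul, abs_of_nonneg (by positivity : (0 : ℝ) ≤ X a ω)]
      have h1 : (X a ω : ℝ) ≤ 1 := by exact_mod_cast hX1 a ω
      calc _ ≤ (1 : ℝ) * 1 := mul_le_mul h1 (hpow1 v hv _) (abs_nonneg _) zero_le_one
        _ = 1 := one_mul _
    have h1 : |∫ ω, (X a ω : ℝ) * v ^ (S I ω - 1) ∂μ - ∫ ω, (X a ω : ℝ) * v ^ S (I \ B a) ω ∂μ| ≤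
        ∑ b ∈ (B a).erase a, μ.real (E a ∩ E b) := by
      rw [← integral_sub hi1 (hXSi v hv _ _), ← Real.norm_eq_abs]
      calc _ ≤ ∫ ω, ∑ b ∈ (B a).erase a, (X a ω : ℝ) * X b ω ∂μ := by
            refine norm_integral_le_of_norm_le
              (integrable_finsetSum _ fun b _ => hXXi a b) (ae_of_all _ fun ω => ?_)
            rw [hpt, ← mul_sub, norm_mul, ← Finset.mul_sum, Real.norm_eq_abs, Nat.abs_cast]
            have := pow_sub_pow_add_le hv.1 hv.2 (S (I \ B a) ω) (S ((B a).erase a) ω)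
            refine mul_le_mul_of_nonneg_left (this.trans_eq ?_) (by positivity)
            simp [hS]
        _ = _ := by
            rw [integral_finsetSum _ fun b _ => hXXi a b]
            exact Finset.sum_congr rfl fun b _ => hXXint a b
    have h2 : |∫ ω, v ^ S (I \ B a) ω ∂μ - φ v| ≤ ∑ b ∈ B a, μ.real (E b) := by
      rw [hφ, ← integral_sub (hSi v hv _) (hSi v hv _), ← Real.norm_eq_abs]
      calc _ ≤ ∫ ω, ∑ b ∈ B a, (X b ω : ℝ) ∂μ := by
            refine norm_integral_le_of_norm_le
              (integrable_finsetSum _ fun b _ => hXi b) (ae_of_all _ fun ω => ?_)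
            rw [hsplit, norm_sub_rev]
            refine (pow_sub_pow_add_le hv.1 hv.2 (S (I \ B a) ω) (S (B a) ω)).trans_eq ?_
            simp [hS]
        _ = _ := by
            rw [integral_finsetSum _ fun b _ => hXi b]
            exact Finset.sum_congr rfl fun b _ => hXint b
    calc |∫ ω, (X a ω : ℝ) * v ^ (S I ω - 1) ∂μ - μ.real (E a) * φ v|
        = |μ.real (E a) * (∫ ω, v ^ S (I \ B a) ω ∂μ - φ v) +
          (∫ ω, (X a ω : ℝ) * v ^ (S I ω - 1) ∂μ - ∫ ω, (X a ω : ℝ) * v ^ S (I \ B a) ω ∂μ)| := by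
          rw [hprod]; congr 1; ring
      _ ≤ μ.real (E a) * ∑ b ∈ B a, μ.real (E b) +
          ∑ b ∈ (B a).erase a, μ.real (E a ∩ E b) := by
          refine (abs_add_le _ _).trans (add_le_add ?_ h1)
          rw [abs_mul, abs_of_nonneg measureReal_nonneg]
          exact mul_le_mul_of_nonneg_left h2 measureReal_nonneg
      _ = _ := by rw [Finset.mul_sum]
  have hdev : ∀ v ∈ Set.Icc (0 : ℝ) 1, |φ' v - l * φ v| ≤
      ∑ a ∈ I, ∑ b ∈ B a, μ.real (E a) * μ.real (E b) +
        ∑ a ∈ I, ∑ b ∈ (B a).erase a, μ.real (E a ∩ E b) := by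
    intro v hv
    have : φ' v = ∑ a ∈ I, ∫ ω, (X a ω : ℝ) * v ^ (S I ω - 1) ∂μ := by
      rw [← integral_finsetSum]
      · simp only [hφ', ← Finset.sum_mul]
        simp [hS]
      · intro a _
        refine hbint _ ((measurable_from_nat.comp (hXm a)).mul
          ((measurable_from_nat (f := fun k : ℕ => v ^ (k - 1))).comp (hSm I))) ⟨1, fun ω => ?_⟩
        rw [abs_mul, abs_of_nonneg (by positivity : (0 : ℝ) ≤ X a ω)]
        have h1 : (X a ω : ℝ) ≤ 1 := by exact_mod_cast hX1 a ω
        calc _ ≤ (1 : ℝ) * 1 := mul_le_mul h1 (hpow1 v hv _) (abs_nonneg _) zero_le_one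
          _ = 1 := one_mul _
    rw [this, hl, Finset.sum_mul, ← Finset.sum_sub_distrib, ← Finset.sum_add_distrib]
    exact (Finset.abs_sum_le_sum_abs _ _).trans (Finset.sum_le_sum fun a ha => hcompare v hv a ha)
  have := abs_sub_exp_neg_le (Finset.sum_nonneg fun a _ => measureReal_nonneg) hderiv hdev hφ1
  rwa [hφ0] at this

end PoissonApproximation

/-! ### Poisson approximation for subtuples of independent points. -/

section UStatistics

variable {Ω α κ : Type*} [MeasurableSpace Ω] [MeasurableSpace α] {μ : Measure Ω}
  [IsProbabilityMeasure μ] {ν : Measure α} [IsProbabilityMeasure ν]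

omit [IsProbabilityMeasure ν] in
lemma map_tuple_eq_pi {U : κ → Ω → α} (hU : ∀ i, Measurable (U i)) (hind : iIndepFun U μ)
    (hlaw : ∀ i, μ.map (U i) = ν) {ι : Type*} [Fintype ι] {e : ι → κ}
    (he : Function.Injective e) :
    μ.map (fun ω k => U (e k) ω) = Measure.pi fun _ : ι => ν := by
  have h := (iIndepFun_iff_map_fun_eq_pi_map (fun i => (hU (e i)).aemeasurable)).1
    (hind.precomp he)
  simpa only [hlaw] using h

/-- A star of `R.card` approximate relations with one common centre. -/
lemma measureReal_star_le {U : κ → Ω → α} (hU : ∀ i, Measurable (U i)) (hind : iIndepFun U μ)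
    (hlaw : ∀ i, μ.map (U i) = ν) {N : Set (α × α)} (hN : MeasurableSet N) {q : ℝ}
    (hq : ∀ u, ν.real {v | (u, v) ∈ N} ≤ q) {i : κ} {R : Finset κ} (hi : i ∉ R) :
    μ.real {ω | ∀ j ∈ R, (U i ω, U j ω) ∈ N} ≤ q ^ R.card := by
  classical
  have hq0 : 0 ≤ q := measureReal_nonneg.trans (hq (Classical.choice (by
    by_contra hne
    rw [not_nonempty_iff] at hne
    have : ν Set.univ = 1 := measure_univ
    rw [Set.univ_eq_empty_iff.2 hne, measure_empty] at this
    exact zero_ne_one this)))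
  have hind' : IndepFun (U i) (fun ω (j : R) => U j ω) μ := by
    have h := hind.indepFun_finset {i} R (by simpa using hi) hU
    exact h.comp (φ := fun x : ({i} : Finset κ) → α => x ⟨i, by simp⟩) (ψ := id)
      (measurable_pi_apply _) measurable_id
  have hRm : Measurable fun ω (j : R) => U j ω := measurable_pi_lambda _ fun j => hU j
  have hmap : μ.map (fun ω => (U i ω, fun j : R => U j ω)) =
      ν.prod (Measure.pi fun _ : R => ν) := by
    rw [(indepFun_iff_map_prod_eq_prod_map_map (hU i).aemeasurable hRm.aemeasurable).1 hind',
      hlaw, map_tuple_eq_pi hU hind hlaw Subtype.val_injective]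
  set D : Set (α × (R → α)) := {x | ∀ j : R, (x.1, x.2 j) ∈ N} with hD
  have hDm : MeasurableSet D := by
    rw [hD, Set.ofPred_forall]
    exact MeasurableSet.iInter fun j =>
      hN.preimage (measurable_fst.prodMk ((measurable_pi_apply j).comp measurable_snd))
  have hset : {ω | ∀ j ∈ R, (U i ω, U j ω) ∈ N} =
      (fun ω => (U i ω, fun j : R => U j ω)) ⁻¹' D := by
    ext ω; simp [hD]
  refine ENNReal.toReal_le_of_le_ofReal (pow_nonneg hq0 _) ?_
  rw [hset, ← Measure.map_apply ((hU i).prodMk hRm) hDm, hmap, Measure.prod_apply hDm]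
  -- With the centre fixed at `u`, the other points are independent and each is related to `u` with
  -- probability at most `q`.
  calc ∫⁻ u, (Measure.pi fun _ : R => ν) (Prod.mk u ⁻¹' D) ∂ν
      ≤ ∫⁻ _, ENNReal.ofReal (q ^ R.card) ∂ν := by
        refine lintegral_mono fun u => ?_
        have : Prod.mk u ⁻¹' D = Set.univ.pi fun _ : R => {v | (u, v) ∈ N} := by
          ext x; simp [hD]
        change (Measure.pi fun _ : R => ν) (Prod.mk u ⁻¹' D) ≤ _
        rw [this, Measure.pi_pi, Finset.prod_const, Finset.card_univ, Fintype.card_coe,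
          ENNReal.ofReal_pow hq0]
        gcongr
        rw [← ofReal_measureReal]
        exact ENNReal.ofReal_le_ofReal (hq u)
    _ = _ := by simp

/-- Counting pairs of finite sets by the size of their union. -/
lemma sum_pow_card_union_le {n : ℕ} (hn : 0 < n) (m : ℕ) :
    ∑ S ∈ Finset.powersetCard m (Finset.univ : Finset (Fin n)),
      ∑ T ∈ Finset.powersetCard m (Finset.univ : Finset (Fin n)),
        ((n : ℝ)⁻¹) ^ (S ∪ T).card ≤ (2 * m + 1) * 16 ^ m := by
  have hn' : (0 : ℝ) < n := by exact_mod_cast hn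
  set A := Finset.powersetCard m (Finset.univ : Finset (Fin n))
  set Q := (Finset.univ : Finset (Finset (Fin n))).filter fun R => R.card ≤ 2 * m
  -- Overcount: keep every `R` containing both sets, of which `S ∪ T` is one.
  have h1 : ∀ S ∈ A, ∀ T ∈ A, ((n : ℝ)⁻¹) ^ (S ∪ T).card ≤
      ∑ R ∈ Q, if S ⊆ R ∧ T ⊆ R then ((n : ℝ)⁻¹) ^ R.card else 0 := by
    intro S hS T hT
    have hmem : S ∪ T ∈ Q := by
      have h1 := Finset.card_union_le S T
      have h2 := (Finset.mem_powersetCard.1 hS).2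
      have h3 := (Finset.mem_powersetCard.1 hT).2
      simp only [Q, Finset.mem_filter, Finset.mem_univ, true_and]
      omega
    refine le_trans ?_ (Finset.single_le_sum (f := fun R : Finset (Fin n) =>
      if S ⊆ R ∧ T ⊆ R then ((n : ℝ)⁻¹) ^ R.card else 0) (fun R _ => ?_) hmem)
    · simp [Finset.subset_union_left, Finset.subset_union_right]
    · split_ifs <;> positivity
  -- A set `R` of size at most `2m` has at most `4 ^ (2m) = 16 ^ m` pairs of subsets.
  have h2 : ∀ R ∈ Q, ∑ S ∈ A, ∑ T ∈ A, (if S ⊆ R ∧ T ⊆ R then ((n : ℝ)⁻¹) ^ R.card else 0) ≤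
      16 ^ m * ((n : ℝ)⁻¹) ^ R.card := by
    intro R hR
    have hR' : R.card ≤ 2 * m := (Finset.mem_filter.1 hR).2
    rw [← Finset.sum_product', ← Finset.sum_filter, Finset.sum_const, nsmul_eq_mul]
    gcongr
    have hsub : (A ×ˢ A).filter (fun x => x.1 ⊆ R ∧ x.2 ⊆ R) ⊆ R.powerset ×ˢ R.powerset := by
      intro x hx
      have := (Finset.mem_filter.1 hx).2
      simpa using this
    have hc := Finset.card_le_card hsub
    rw [Finset.card_product, Finset.card_powerset, ← pow_add] at hc
    have : 2 ^ (R.card + R.card) ≤ 16 ^ m := by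
      rw [show (16 : ℕ) = 2 ^ 4 by norm_num, ← pow_mul]
      exact Nat.pow_le_pow_right two_pos (by omega)
    exact_mod_cast hc.trans this
  -- At most `n ^ k` sets have size `k`, so each of the `2m + 1` sizes contributes at most `1`.
  have h3 : ∑ R ∈ Q, ((n : ℝ)⁻¹) ^ R.card ≤ 2 * m + 1 := by
    have hmaps : ∀ R ∈ Q, R.card ∈ Finset.range (2 * m + 1) := by
      intro R hR
      have hR' : R.card ≤ 2 * m := (Finset.mem_filter.1 hR).2
      simp; omega
    rw [← Finset.sum_fiberwise_of_maps_to hmaps]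
    calc _ ≤ ∑ k ∈ Finset.range (2 * m + 1), (1 : ℝ) := by
          refine Finset.sum_le_sum fun k _ => ?_
          calc ∑ R ∈ Q with R.card = k, ((n : ℝ)⁻¹) ^ R.card
              = ∑ R ∈ Q with R.card = k, ((n : ℝ)⁻¹) ^ k :=
                Finset.sum_congr rfl fun R hR => by rw [(Finset.mem_filter.1 hR).2]
            _ = ((Q.filter fun R => R.card = k).card : ℝ) * ((n : ℝ)⁻¹) ^ k := by
                rw [Finset.sum_const, nsmul_eq_mul]
            _ ≤ (n : ℝ) ^ k * ((n : ℝ)⁻¹) ^ k := by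
                gcongr
                have hsub : (Q.filter fun R => R.card = k) ⊆
                    Finset.powersetCard k (Finset.univ : Finset (Fin n)) := fun R hR =>
                  Finset.mem_powersetCard.2 ⟨Finset.subset_univ _, (Finset.mem_filter.1 hR).2⟩
                have hc := Finset.card_le_card hsub
                rw [Finset.card_powersetCard, Finset.card_univ, Fintype.card_fin] at hc
                exact_mod_cast hc.trans (Nat.choose_le_pow n k)
            _ = 1 := by rw [← mul_pow, mul_inv_cancel₀ hn'.ne', one_pow]
      _ = _ := by simp
  calc _ ≤ ∑ S ∈ A, ∑ T ∈ A, ∑ R ∈ Q,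
        if S ⊆ R ∧ T ⊆ R then ((n : ℝ)⁻¹) ^ R.card else 0 :=
        Finset.sum_le_sum fun S hS => Finset.sum_le_sum fun T hT => h1 S hS T hT
    _ = ∑ R ∈ Q, ∑ S ∈ A, ∑ T ∈ A, if S ⊆ R ∧ T ⊆ R then ((n : ℝ)⁻¹) ^ R.card else 0 := by
        rw [Finset.sum_congr rfl fun S _ => Finset.sum_comm, Finset.sum_comm]
    _ ≤ ∑ R ∈ Q, 16 ^ m * ((n : ℝ)⁻¹) ^ R.card := Finset.sum_le_sum h2
    _ ≤ _ := by
        rw [← Finset.mul_sum, mul_comm]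
        gcongr

lemma card_orderEmbedding_fin (m n : ℕ) [Fintype (Fin m ↪o Fin n)] :
    Fintype.card (Fin m ↪o Fin n) = n.choose m := by
  rw [← Nat.card_eq_fintype_card, Nat.card_congr Set.powersetCard.ofFinEmbEquiv,
    Set.powersetCard.card, Nat.card_eq_fintype_card, Fintype.card_fin]

/-- Poisson approximation for `U`-statistics: if the tuples in `A` have pairwise related entries,
and a point is related to a random point with probability at most `q`, then the probability that
no `m`-subtuple of `n` random points lies in `A` is close to `exp (-(n.choose m) * P A)`. -/
theorem abs_measureReal_forall_notMem_sub_exp_le {n m : ℕ} (hn : 0 < n) (hm : 2 ≤ m)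
    {U : Fin n → Ω → α} (hU : ∀ i, Measurable (U i)) (hind : iIndepFun U μ)
    (hlaw : ∀ i, μ.map (U i) = ν) {A : Set (Fin m → α)} (hA : MeasurableSet A)
    {N : Set (α × α)} (hN : MeasurableSet N)
    (hAN : ∀ x ∈ A, ∀ i j, i ≠ j → (x i, x j) ∈ N) {q : ℝ} (hq0 : 0 ≤ q)
    (hq : ∀ u, ν.real {v | (u, v) ∈ N} ≤ q) (hnq : n * q ≤ 1) :
    |μ.real {ω | ∀ J : Fin m ↪o Fin n, (fun k => U (J k) ω) ∉ A} -
        Real.exp (-(n.choose m * (Measure.pi fun _ : Fin m => ν).real A))| ≤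
      2 * ((2 * m + 1) * 16 ^ m) * (n * (n * q) ^ m) := by
  classical
  have hn' : (0 : ℝ) < n := by exact_mod_cast hn
  have hn1 : (1 : ℝ) ≤ n := by exact_mod_cast hn
  have : Fintype (Fin m ↪o Fin n) := Fintype.ofInjective (fun J => (J : Fin m → Fin n))
    DFunLike.coe_injective
  set r : (Fin m ↪o Fin n) → Finset (Fin n) := fun J => Finset.univ.map J.toEmbedding with hr
  have hrmem : ∀ J k, J k ∈ r J := fun J k => by simp [hr]
  have hrc : ∀ J, (r J).card = m := fun J => by simp [hr]
  have hrinj : Function.Injective r := by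
    intro J J' h
    rw [← OrderEmbedding.range_inj]
    have h2 : ((r J : Finset (Fin n)) : Set (Fin n)) = r J' := by rw [h]
    simpa [hr] using h2
  set E : (Fin m ↪o Fin n) → Set Ω := fun J => {ω | (fun k => U (J k) ω) ∈ A} with hE
  have hEm : ∀ J, MeasurableSet (E J) := fun J =>
    hA.preimage (measurable_pi_lambda _ fun k => hU (J k))
  have hEp : ∀ J, μ.real (E J) = (Measure.pi fun _ : Fin m => ν).real A := by
    intro J
    rw [← map_tuple_eq_pi hU hind hlaw J.injective,
      map_measureReal_apply (measurable_pi_lambda _ fun k => hU (J k)) hA]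
    rfl
  -- A common index is the centre of a star through all the other indices of the union.
  have hEE : ∀ J J', ¬ Disjoint (r J) (r J') →
      μ.real (E J ∩ E J') ≤ q ^ ((r J ∪ r J').card - 1) := by
    intro J J' hJ
    obtain ⟨i, hi, hi'⟩ := Finset.not_disjoint_iff.1 hJ
    have hiu : i ∈ r J ∪ r J' := Finset.mem_union_left _ hi
    rw [← Finset.card_erase_of_mem hiu]
    refine le_trans (measureReal_mono ?_) (measureReal_star_le hU hind hlaw hN hq
      (Finset.notMem_erase i (r J ∪ r J')))
    rintro ω ⟨h1, h2⟩ j hj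
    obtain ⟨hji, hj⟩ := Finset.mem_erase.1 hj
    obtain ⟨k, -, hk⟩ := Finset.mem_map.1 hi
    obtain ⟨k', -, hk'⟩ := Finset.mem_map.1 hi'
    rcases Finset.mem_union.1 hj with hj | hj
    · obtain ⟨l, -, hl⟩ := Finset.mem_map.1 hj
      subst hl
      have := hAN _ h1 k l (by rintro rfl; exact hji hk)
      rw [← hk]
      exact this
    · obtain ⟨l, -, hl⟩ := Finset.mem_map.1 hj
      subst hl
      have := hAN _ h2 k' l (by rintro rfl; exact hji hk')
      rw [← hk']
      exact this
  have hEq : ∀ J, μ.real (E J) ≤ q ^ (m - 1) := by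
    intro J
    have := hEE J J (by
      rw [disjoint_self, Finset.bot_eq_empty, ← Finset.card_eq_zero, hrc]; omega)
    simpa [hrc] using this
  set B : (Fin m ↪o Fin n) → Finset (Fin m ↪o Fin n) := fun J =>
    Finset.univ.filter fun J' => ¬ Disjoint (r J) (r J') with hB
  have hBself : ∀ J, J ∈ B J := fun J => by
    simp only [hB, Finset.mem_filter, Finset.mem_univ, true_and]
    rw [disjoint_self, Finset.bot_eq_empty, ← Finset.card_eq_zero, hrc]; omega
  have hindep : ∀ J ∈ (Finset.univ : Finset (Fin m ↪o Fin n)),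
      IndepFun ((E J).indicator (fun _ => (1 : ℕ)))
      (fun ω => ∑ b ∈ Finset.univ \ B J, (E b).indicator (fun _ => (1 : ℕ)) ω) μ := by
    intro J _
    have h := hind.indepFun_finset (r J) (r J)ᶜ disjoint_compl_right hU
    have h2 : ∀ b ∈ Finset.univ \ B J, ∀ k, b k ∈ (r J)ᶜ := by
      intro b hb k
      have hb' : Disjoint (r J) (r b) := by simpa [hB] using hb
      rw [Finset.mem_compl]
      exact fun hk => Finset.disjoint_left.1 hb' hk (hrmem b k)
    have hφ : Measurable (A.indicator (fun _ => (1 : ℕ)) ∘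
        fun (x : r J → α) (k : Fin m) => x ⟨J k, hrmem J k⟩) :=
      (measurable_const.indicator hA).comp (measurable_pi_lambda _ fun k => measurable_pi_apply _)
    have hψ : Measurable fun x : ((r J)ᶜ : Finset (Fin n)) → α =>
        ∑ b ∈ (Finset.univ \ B J).attach,
          A.indicator (fun _ => (1 : ℕ)) fun k => x ⟨b.1 k, h2 b.1 b.2 k⟩ :=
      Finset.measurable_sum _ fun b _ =>
        (measurable_const.indicator hA).comp (measurable_pi_lambda _ fun k => measurable_pi_apply _)
    have h3 := h.comp hφ hψ
    convert h3 using 1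
    · rfl
    · ext ω
      rw [← Finset.sum_attach]
      rfl
  have hmain := abs_measureReal_iInter_compl_sub_exp_le μ Finset.univ E hEm B
    (fun _ _ => Finset.subset_univ _) (fun J _ => hBself J) hindep
  have hset : (⋂ J ∈ (Finset.univ : Finset (Fin m ↪o Fin n)), (E J)ᶜ) =
      {ω | ∀ J : Fin m ↪o Fin n, (fun k => U (J k) ω) ∉ A} := by
    ext ω; simp [hE]
  have hsum : ∑ J, μ.real (E J) = n.choose m * (Measure.pi fun _ : Fin m => ν).real A := by
    simp only [hEp, Finset.sum_const, Finset.card_univ, card_orderEmbedding_fin, nsmul_eq_mul]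
  rw [hset, hsum] at hmain
  refine hmain.trans ?_
  have hnq0 : 0 ≤ n * q := by positivity
  set w : (Fin m ↪o Fin n) → (Fin m ↪o Fin n) → ℝ := fun J J' =>
    ((n : ℝ)⁻¹) ^ (r J ∪ r J').card with hw
  have hw0 : ∀ J J', 0 ≤ w J J' := fun J J' => by positivity
  have hcard : ∀ J J', ¬ Disjoint (r J) (r J') → (r J ∪ r J').card ≤ 2 * m - 1 := by
    intro J J' hJ
    have h1 := Finset.card_union_add_card_inter (r J) (r J')
    have h2 : 0 < (r J ∩ r J').card :=
      Finset.card_pos.2 (Finset.not_disjoint_iff_nonempty_inter.1 hJ)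
    rw [hrc, hrc] at h1
    omega
  -- Overlap bounds the union by `2m - 1`; lowering the exponent of `n q ≤ 1` from `2m - 2` to `m`
  -- uses `m ≥ 2`.
  have hterm1 : ∀ J, ∀ J' ∈ B J, μ.real (E J) * μ.real (E J') ≤ n * (n * q) ^ m * w J J' := by
    intro J J' hJ'
    have hk := hcard J J' (by simpa [hB] using hJ')
    calc μ.real (E J) * μ.real (E J') ≤ q ^ (m - 1) * q ^ (m - 1) :=
          mul_le_mul (hEq J) (hEq J') measureReal_nonneg (by positivity)
      _ = n * (n * q) ^ (m - 1 + (m - 1)) * ((n : ℝ)⁻¹) ^ (2 * m - 1) := by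
          rw [← pow_add, mul_pow, show 2 * m - 1 = (m - 1 + (m - 1)) + 1 by omega, pow_succ, inv_pow]
          field_simp
      _ ≤ n * (n * q) ^ m * w J J' := by
          refine mul_le_mul (mul_le_mul_of_nonneg_left
            (pow_le_pow_of_le_one hnq0 hnq (by omega)) hn'.le)
            (pow_le_pow_of_le_one (by positivity) (inv_le_one_of_one_le₀ hn1) hk)
            (by positivity) (by positivity)
  -- Distinct increasing tuples have distinct ranges, so the union has at least `m + 1` indices and
  -- the star bound carries at least `m` factors `q`.
  have hterm2 : ∀ J, ∀ J' ∈ (B J).erase J, μ.real (E J ∩ E J') ≤ n * (n * q) ^ m * w J J' := by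
    intro J J' hJ'
    obtain ⟨hne, hJ'⟩ := Finset.mem_erase.1 hJ'
    have hd : ¬ Disjoint (r J) (r J') := by simpa [hB] using hJ'
    have hk : m + 1 ≤ (r J ∪ r J').card := by
      by_contra hlt
      have h1 : r J = r J ∪ r J' := Finset.eq_of_subset_of_card_le Finset.subset_union_left
        (by rw [hrc]; omega)
      have h2 : r J' = r J ∪ r J' := Finset.eq_of_subset_of_card_le Finset.subset_union_right
        (by rw [hrc]; omega)
      exact hne (hrinj (h2.trans h1.symm))
    calc μ.real (E J ∩ E J') ≤ q ^ ((r J ∪ r J').card - 1) := hEE J J' hd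
      _ = n * (n * q) ^ ((r J ∪ r J').card - 1) * w J J' := by
          obtain ⟨k, hk'⟩ : ∃ k, (r J ∪ r J').card = k + 1 := ⟨(r J ∪ r J').card - 1, by omega⟩
          rw [hw]
          dsimp only
          rw [hk', Nat.add_sub_cancel, mul_pow, pow_succ, inv_pow]
          field_simp
      _ ≤ n * (n * q) ^ m * w J J' := by
          refine mul_le_mul_of_nonneg_right (mul_le_mul_of_nonneg_left
            (pow_le_pow_of_le_one hnq0 hnq (by omega)) hn'.le) (hw0 _ _)
  have hW : ∑ J, ∑ J', w J J' ≤ (2 * m + 1) * 16 ^ m := by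
    refine le_trans ?_ (sum_pow_card_union_le hn m)
    have himg : Finset.univ.image r ⊆ Finset.powersetCard m (Finset.univ : Finset (Fin n)) := by
      intro S hS
      obtain ⟨J, -, rfl⟩ := Finset.mem_image.1 hS
      exact Finset.mem_powersetCard.2 ⟨Finset.subset_univ _, hrc J⟩
    calc ∑ J, ∑ J', w J J' = ∑ S ∈ Finset.univ.image r, ∑ T ∈ Finset.univ.image r,
          ((n : ℝ)⁻¹) ^ (S ∪ T).card := by
          rw [Finset.sum_image hrinj.injOn]
          exact Finset.sum_congr rfl fun J _ => by rw [Finset.sum_image hrinj.injOn]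
      _ ≤ _ := by
          refine (Finset.sum_le_sum_of_subset_of_nonneg himg fun S _ _ =>
            Finset.sum_nonneg fun T _ => by positivity).trans
            (Finset.sum_le_sum fun S _ => Finset.sum_le_sum_of_subset_of_nonneg himg
              fun T _ _ => by positivity)
  have hbound : ∀ (F : (Fin m ↪o Fin n) → (Fin m ↪o Fin n) → ℝ)
      (D : (Fin m ↪o Fin n) → Finset (Fin m ↪o Fin n)),
      (∀ J, ∀ J' ∈ D J, F J J' ≤ n * (n * q) ^ m * w J J') →
      ∑ J, ∑ J' ∈ D J, F J J' ≤ n * (n * q) ^ m * ((2 * m + 1) * 16 ^ m) := by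
    intro F D hF
    calc ∑ J, ∑ J' ∈ D J, F J J' ≤ ∑ J, ∑ J', n * (n * q) ^ m * w J J' :=
          Finset.sum_le_sum fun J _ => (Finset.sum_le_sum (hF J)).trans
            (Finset.sum_le_sum_of_subset_of_nonneg (Finset.subset_univ _) fun J' _ _ =>
              mul_nonneg (by positivity) (hw0 _ _))
      _ = n * (n * q) ^ m * ∑ J, ∑ J', w J J' := by simp only [Finset.mul_sum]
      _ ≤ _ := mul_le_mul_of_nonneg_left hW (by positivity)
  have h1 := hbound (fun J J' => μ.real (E J) * μ.real (E J')) B hterm1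
  have h2 := hbound (fun J J' => μ.real (E J ∩ E J')) (fun J => (B J).erase J) hterm2
  linarith

end UStatistics

/-! ### Ellipsoids and positive definite forms. -/

section QuadraticForms

open scoped Matrix

variable {d : ℕ}

/-- Volume of an ellipsoid. -/
lemma volume_sum_mulVec_sq (hd : 1 ≤ d) (B : Matrix (Fin d) (Fin d) ℝ) (hB : B.det ≠ 0) :
    volume.real {y : Fin d → ℝ | ∑ i, (B *ᵥ y) i ^ 2 ≤ 2} =
      (2 * Real.pi) ^ ((d : ℝ) / 2) / Real.Gamma (((d : ℝ) + 2) / 2) * (1 / |B.det|) ∧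
    volume {y : Fin d → ℝ | ∑ i, (B *ᵥ y) i ^ 2 = 2} = 0 := by
  have : Nonempty (Fin d) := ⟨⟨0, hd⟩⟩
  have hdet : LinearMap.det (Matrix.toLin' B) ≠ 0 := by rwa [LinearMap.det_toLin']
  have hle : ∀ x : Fin d → ℝ, (∑ i, |x i| ^ (2 : ℝ)) ^ (1 / (2 : ℝ)) ≤ √2 ↔ ∑ i, x i ^ 2 ≤ 2 := by
    intro x
    simp only [Real.rpow_two, sq_abs]
    rw [← Real.sqrt_eq_rpow, Real.sqrt_le_sqrt_iff zero_le_two]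
  have hlt : ∀ x : Fin d → ℝ, (∑ i, |x i| ^ (2 : ℝ)) ^ (1 / (2 : ℝ)) < √2 ↔ ∑ i, x i ^ 2 < 2 := by
    intro x
    simp only [Real.rpow_two, sq_abs]
    rw [← Real.sqrt_eq_rpow, Real.sqrt_lt_sqrt_iff (by positivity)]
  have hv1 := volume_sum_rpow_le (ι := Fin d) (p := 2) one_le_two (√2)
  have hv2 := volume_sum_rpow_lt (ι := Fin d) (p := 2) one_le_two (√2)
  simp only [hle] at hv1
  simp only [hlt] at hv2
  have hp1 := Measure.addHaar_preimage_linearMap volume hdet {x : Fin d → ℝ | ∑ i, x i ^ 2 ≤ 2}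
  have hp2 := Measure.addHaar_preimage_linearMap volume hdet {x : Fin d → ℝ | ∑ i, x i ^ 2 < 2}
  rw [hv1] at hp1
  rw [hv2] at hp2
  have hs1 : (Matrix.toLin' B) ⁻¹' {x : Fin d → ℝ | ∑ i, x i ^ 2 ≤ 2} =
      {y : Fin d → ℝ | ∑ i, (B *ᵥ y) i ^ 2 ≤ 2} := by ext y; simp
  have hs2 : (Matrix.toLin' B) ⁻¹' {x : Fin d → ℝ | ∑ i, x i ^ 2 < 2} =
      {y : Fin d → ℝ | ∑ i, (B *ᵥ y) i ^ 2 < 2} := by ext y; simp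
  rw [hs1] at hp1
  rw [hs2] at hp2
  constructor
  · rw [measureReal_def, hp1, LinearMap.det_toLin', Fintype.card_fin,
      ENNReal.toReal_mul, ENNReal.toReal_mul, ENNReal.toReal_pow,
      ENNReal.toReal_ofReal (abs_nonneg _), ENNReal.toReal_ofReal (Real.sqrt_nonneg _),
      ENNReal.toReal_ofReal (div_nonneg (by
        have := Real.Gamma_pos_of_pos (show (0 : ℝ) < 1 / 2 + 1 by norm_num)
        positivity) (Real.Gamma_pos_of_pos (by positivity)).le)]
    have hG : Real.Gamma (1 / 2 + 1) = √Real.pi / 2 := by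
      rw [Real.Gamma_add_one (by norm_num), Real.Gamma_one_half_eq]; ring
    have hpow : √2 ^ d * (2 * (√Real.pi / 2)) ^ d = (2 * Real.pi) ^ ((d : ℝ) / 2) := by
      rw [← mul_pow, mul_div_cancel₀ _ two_ne_zero, ← Real.sqrt_mul zero_le_two,
        Real.sqrt_eq_rpow, ← Real.rpow_natCast, ← Real.rpow_mul (by positivity)]
      congr 1; ring
    rw [hG, show (d : ℝ) / 2 + 1 = ((d : ℝ) + 2) / 2 by ring, ← mul_div_assoc, hpow, abs_inv]
    ring
  -- The boundary is null because the closed and open ellipsoids have the same finite volume.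
  · have hsub : {y : Fin d → ℝ | ∑ i, (B *ᵥ y) i ^ 2 = 2} =
        {y : Fin d → ℝ | ∑ i, (B *ᵥ y) i ^ 2 ≤ 2} \
          {y : Fin d → ℝ | ∑ i, (B *ᵥ y) i ^ 2 < 2} := by
      ext y
      simp only [Set.mem_ofPred_eq, Set.mem_sdiff, not_lt]
      exact le_antisymm_iff
    have hcont : Continuous fun y : Fin d → ℝ => ∑ i, (B *ᵥ y) i ^ 2 :=
      continuous_finsetSum _ fun i _ => ((continuous_apply i).comp
        (continuous_const.matrix_mulVec continuous_id)).pow 2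
    rw [hsub, measure_sdiff _ (measurableSet_lt hcont.measurable measurable_const).nullMeasurableSet,
      hp1, hp2, tsub_self]
    · rw [hp2]
      exact ENNReal.mul_ne_top ENNReal.ofReal_ne_top (ENNReal.mul_ne_top
        (ENNReal.pow_ne_top ENNReal.ofReal_ne_top) ENNReal.ofReal_ne_top)
    · exact fun y hy => (Set.mem_ofPred.1 hy).le

/-- Invertibility gives `‖y‖ ≤ ‖B⁻¹‖ ‖B y‖`, and the sup norm is at most the Euclidean one. The `+
1` keeps the constant positive when `B⁻¹` has norm zero, as for `d = 0`. -/
lemma exists_pos_mul_norm_sq_le (B : Matrix (Fin d) (Fin d) ℝ) (hB : B.det ≠ 0) :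
    ∃ c > 0, ∀ y : Fin d → ℝ, c * ‖y‖ ^ 2 ≤ ∑ i, (B *ᵥ y) i ^ 2 := by
  set L : (Fin d → ℝ) →L[ℝ] (Fin d → ℝ) := LinearMap.toContinuousLinearMap (Matrix.toLin' B⁻¹)
  refine ⟨((‖L‖ + 1) ^ 2)⁻¹, by positivity, fun y => ?_⟩
  have hy : y = L (B *ᵥ y) := by
    simp [L, Matrix.nonsing_inv_mul _ (isUnit_iff_ne_zero.2 hB)]
  have h1 : ‖y‖ ≤ (‖L‖ + 1) * ‖B *ᵥ y‖ := by
    calc ‖y‖ = ‖L (B *ᵥ y)‖ := by rw [← hy]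
      _ ≤ ‖L‖ * ‖B *ᵥ y‖ := L.le_opNorm _
      _ ≤ _ := by gcongr; linarith
  have h2 : ‖B *ᵥ y‖ ^ 2 ≤ ∑ i, (B *ᵥ y) i ^ 2 := by
    rw [← Real.le_sqrt (norm_nonneg _) (by positivity)]
    refine (pi_norm_le_iff_of_nonneg (Real.sqrt_nonneg _)).2 fun i => ?_
    rw [Real.norm_eq_abs, ← Real.sqrt_sq_eq_abs]
    exact Real.sqrt_le_sqrt (Finset.single_le_sum (f := fun i => (B *ᵥ y) i ^ 2)
      (fun j _ => sq_nonneg _) (Finset.mem_univ i))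
  rw [inv_mul_le_iff₀ (by positivity)]
  calc ‖y‖ ^ 2 ≤ ((‖L‖ + 1) * ‖B *ᵥ y‖) ^ 2 := by gcongr
    _ = (‖L‖ + 1) ^ 2 * ‖B *ᵥ y‖ ^ 2 := mul_pow _ _ _
    _ ≤ _ := by gcongr

end QuadraticForms

/-! ### Second-order expansion at a nondegenerate maximum. -/

section Taylor

/-- Second-order Taylor expansion at a critical point. -/
lemma isLittleO_taylor_two {E : Type*} [NormedAddCommGroup E] [NormedSpace ℝ E] {g : E → ℝ} {V : E}
    (hg : ContDiffAt ℝ 2 g V) (h0 : fderiv ℝ g V = 0) :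
    (fun z => g (V + z) - g V - (1 / 2) * fderiv ℝ (fderiv ℝ g) V z z) =o[𝓝 0]
      fun z => ‖z‖ ^ 2 := by
  set T := fderiv ℝ (fderiv ℝ g) V with hT
  have hsymm : ∀ v w, T v w = T w v := hg.isSymmSndFDerivAt (by simp)
  have hdiff : HasFDerivAt (fderiv ℝ g) T V :=
    ((hg.fderiv_right (m := 1) (by norm_num)).differentiableAt one_ne_zero).hasFDerivAt
  have hev : ∀ᶠ y in 𝓝 V, DifferentiableAt ℝ g y :=
    (hg.eventually (by simp)).mono fun y hy => hy.differentiableAt two_ne_zero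
  rw [Asymptotics.isLittleO_iff]
  intro ε hε
  have h1 : ∀ᶠ z in 𝓝 (0 : E), ‖fderiv ℝ g (V + z) - T z‖ ≤ ε * ‖z‖ := by
    have := (hasFDerivAt_iff_isLittleO_nhds_zero.1 hdiff).def hε
    simpa [h0] using this
  have hV : Tendsto (fun z : E => V + z) (𝓝 0) (𝓝 V) := by
    have : Continuous fun z : E => V + z := by fun_prop
    simpa using this.tendsto 0
  obtain ⟨r, hr, hball⟩ := Metric.eventually_nhds_iff_ball.1 (h1.and (hV.eventually hev))
  filter_upwards [Metric.ball_mem_nhds 0 hr] with z hz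
  have hsub : Metric.closedBall (0 : E) ‖z‖ ⊆ Metric.ball 0 r :=
    Metric.closedBall_subset_ball (by simpa using hz)
  -- The mean value inequality is applied to the remainder itself. Symmetry of the second derivative
  -- makes `T w` the derivative of `(1/2) T w w`, so what is left is the first-order error of
  -- `fderiv ℝ g` at `V`.
  have hder : ∀ w ∈ Metric.closedBall (0 : E) ‖z‖,
      HasFDerivWithinAt (fun w => g (V + w) - (1 / 2) * T w w) (fderiv ℝ g (V + w) - T w)
        (Metric.closedBall (0 : E) ‖z‖) w := by
    intro w hw
    have hd1 : HasFDerivAt (fun w => g (V + w)) (fderiv ℝ g (V + w)) w := by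
      have := (hball w (hsub hw)).2.hasFDerivAt
      exact HasFDerivAt.comp w this ((hasFDerivAt_id w).const_add V)
    have hd2 : HasFDerivAt (fun w => T w w) (T.flip w + T w) w := by
      have := T.hasFDerivAt (x := w) |>.clm_apply (hasFDerivAt_id w)
      refine this.congr_fderiv ?_
      ext v
      simp [add_comm]
    refine (hd1.sub (hd2.const_mul (1 / 2))).hasFDerivWithinAt.congr_fderiv ?_
    ext v
    simp [hsymm v w]
    ring
  have hbd : ∀ w ∈ Metric.closedBall (0 : E) ‖z‖, ‖fderiv ℝ g (V + w) - T w‖ ≤ ε * ‖z‖ := by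
    intro w hw
    refine (hball w (hsub hw)).1.trans ?_
    have : ‖w‖ ≤ ‖z‖ := by simpa using hw
    gcongr
  have := (convex_closedBall (0 : E) ‖z‖).norm_image_sub_le_of_norm_hasFDerivWithin_le hder hbd
    (Metric.mem_closedBall_self (norm_nonneg z)) (by simp : z ∈ Metric.closedBall (0 : E) ‖z‖)
  simp only [add_zero, map_zero, mul_zero, sub_zero] at this
  rw [Real.norm_of_nonneg (sq_nonneg ‖z‖), sq, ← mul_assoc]
  rw [sub_right_comm]
  exact this

open scoped Matrix

lemma hessianMatrix_apply {d : ℕ} {g : (Fin d → ℝ) → ℝ} {V : Fin d → ℝ}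
    (hg : ContDiffAt ℝ 2 g V) (a b : Fin d) :
    hessianMatrix g V a b = fderiv ℝ (fderiv ℝ g) V (Pi.single a 1) (Pi.single b 1) := by
  have hdiff : DifferentiableAt ℝ (fderiv ℝ g) V :=
    (hg.fderiv_right (m := 1) (by norm_num)).differentiableAt one_ne_zero
  rw [hessianMatrix, Matrix.of_apply, fderiv_clm_apply hdiff (by fun_prop)]
  simp

lemma dotProduct_hessianMatrix_mulVec {d : ℕ} {g : (Fin d → ℝ) → ℝ} {V : Fin d → ℝ}
    (hg : ContDiffAt ℝ 2 g V) (z : Fin d → ℝ) :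
    z ⬝ᵥ hessianMatrix g V *ᵥ z = fderiv ℝ (fderiv ℝ g) V z z := by
  have hz : z = ∑ i, z i • (Pi.single i (1 : ℝ) : Fin d → ℝ) := by
    ext j
    simp [Finset.sum_apply, Pi.single_apply]
  conv_rhs => rw [hz]
  simp only [map_sum, map_smul, _root_.sum_apply, _root_.smul_apply,
    dotProduct, Matrix.mulVec, hessianMatrix_apply hg, smul_eq_mul, Finset.mul_sum]
  rw [Finset.sum_comm]
  refine Finset.sum_congr rfl fun i _ => Finset.sum_congr rfl fun j _ => by ring

/-- At a nondegenerate local maximum the negative Hessian is a Gram matrix. -/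
lemma exists_neg_hessianMatrix_eq {d : ℕ} {g : (Fin d → ℝ) → ℝ} {V : Fin d → ℝ}
    (hg : ContDiffAt ℝ 2 g V) (hmax : IsLocalMax g V) (hdet : (hessianMatrix g V).det ≠ 0) :
    ∃ B : Matrix (Fin d) (Fin d) ℝ, B.det ≠ 0 ∧ |B.det| = √(-hessianMatrix g V).det ∧
      (fun z => g V - g (V + z) - (1 / 2) * ∑ i, (B *ᵥ z) i ^ 2) =o[𝓝 0] fun z => ‖z‖ ^ 2 := by
  set A := -hessianMatrix g V with hA
  have hsymm : ∀ v w, fderiv ℝ (fderiv ℝ g) V v w = fderiv ℝ (fderiv ℝ g) V w v :=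
    hg.isSymmSndFDerivAt (by simp)
  have htay := isLittleO_taylor_two hg hmax.fderiv_eq_zero
  have hQ : ∀ z, z ⬝ᵥ A *ᵥ z = -fderiv ℝ (fderiv ℝ g) V z z := by
    intro z
    rw [hA, Matrix.neg_mulVec, dotProduct_neg, dotProduct_hessianMatrix_mulVec hg]
  -- Along the ray `V + s y` maximality bounds `(s²/2) T y y` by the Taylor error. The tolerance is
  -- chosen to make that error at most `s² ε / 2`; its `+ 1` covers `y = 0`.
  have hpos : ∀ y, 0 ≤ y ⬝ᵥ A *ᵥ y := by
    intro y
    rw [hQ]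
    have hlim : Tendsto (fun s : ℝ => s • y) (𝓝[>] 0) (𝓝 0) := by
      have : Continuous fun s : ℝ => s • y := by fun_prop
      simpa using (this.tendsto 0).mono_left nhdsWithin_le_nhds
    have hV : Tendsto (fun s : ℝ => V + s • y) (𝓝[>] 0) (𝓝 V) := by
      simpa using hlim.const_add V
    have hmax' := hV.eventually hmax
    refine le_of_forall_pos_le_add fun ε hε => ?_
    have hlo := (htay.comp_tendsto hlim).def (show 0 < ε / (2 * (‖y‖ ^ 2 + 1)) by positivity)
    obtain ⟨s, h1, h2, hs⟩ := (hmax'.and (hlo.and self_mem_nhdsWithin)).exists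
    have hs : 0 < s := hs
    simp only [Function.comp, map_smul, _root_.smul_apply, smul_eq_mul, norm_smul,
      Real.norm_eq_abs, abs_of_pos hs] at h2
    rw [abs_of_nonneg (by positivity : 0 ≤ (s * ‖y‖) ^ 2)] at h2
    have h3 := (abs_le.1 h2).1
    have h4 : ε / (2 * (‖y‖ ^ 2 + 1)) * (s * ‖y‖) ^ 2 ≤ s * s * (ε / 2) := by
      rw [div_mul_eq_mul_div, div_le_iff₀ (by positivity)]
      have : 0 ≤ s * s * ε := by positivity
      nlinarith
    have h5 : s * s * (fderiv ℝ (fderiv ℝ g) V y y) ≤ s * s * ε := by nlinarith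
    have := le_of_mul_le_mul_left h5 (by positivity)
    linarith
  have hherm : A.IsHermitian := by
    ext a b
    simp [hA, hessianMatrix_apply hg, hsymm (Pi.single a 1)]
  have hpsd : A.PosSemidef := Matrix.PosSemidef.of_dotProduct_mulVec_nonneg hherm
    fun x => by simpa using hpos x
  -- Positive semidefiniteness already gives `A = Bᵀ B`; the nonzero determinant then makes `B`
  -- invertible.
  open scoped MatrixOrder in
  obtain ⟨B, hB⟩ := CStarAlgebra.nonneg_iff_eq_star_mul_self.mp hpsd.nonneg
  have hBdet : A.det = B.det ^ 2 := by
    rw [hB, Matrix.det_mul, Matrix.star_eq_conjTranspose, Matrix.det_conjTranspose]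
    simp [sq]
  have hAdet : A.det ≠ 0 := by
    rw [hA, Matrix.det_neg]
    exact mul_ne_zero (pow_ne_zero _ (by norm_num)) hdet
  refine ⟨B, ?_, ?_, ?_⟩
  · intro h0
    rw [hBdet, h0] at hAdet
    simp at hAdet
  · rw [hBdet, Real.sqrt_sq_eq_abs]
  · have hBQ : ∀ z, ∑ i, (B *ᵥ z) i ^ 2 = -fderiv ℝ (fderiv ℝ g) V z z := by
      intro z
      rw [← hQ, hB, Matrix.star_eq_conjTranspose, Matrix.conjTranspose_eq_transpose_of_trivial,
        ← Matrix.mulVec_mulVec, Matrix.dotProduct_mulVec, Matrix.vecMul_transpose]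
      simp [dotProduct, sq]
    refine (htay.neg_left).congr_left fun z => ?_
    rw [hBQ]
    ring

end Taylor

/-! ### Local Laplace asymptotics. -/

section Laplace

open scoped Matrix

variable {d : ℕ}

lemma measurableSet_ball_inter_le {g : (Fin d → ℝ) → ℝ} {V : Fin d → ℝ} {r : ℝ}
    (hg : ContinuousOn g (Metric.ball V r)) (a : ℝ) :
    MeasurableSet (Metric.ball V r ∩ {β | a ≤ g β}) := by
  obtain ⟨u, hu, hu'⟩ := continuousOn_iff_isClosed.1 hg (Set.Ici a) isClosed_Ici
  have : Metric.ball V r ∩ {β | a ≤ g β} = u ∩ Metric.ball V r := by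
    rw [← hu', Set.inter_comm]; rfl
  rw [this]
  exact hu.measurableSet.inter Metric.isOpen_ball.measurableSet

/-- Laplace asymptotics: the `Φ`-mass of the superlevel sets of `g` near a nondegenerate
local maximum `V`, together with the quadratic decay of `g` away from `V`. -/
theorem tendsto_setIntegral_superlevel (hd : 1 ≤ d) {g : (Fin d → ℝ) → ℝ} {V : Fin d → ℝ}
    (hg : ContDiffAt ℝ 2 g V) (hmax : IsLocalMax g V) (hdet : (hessianMatrix g V).det ≠ 0) :
    ∃ r₀ > 0, ∃ c > 0, (∀ β ∈ Metric.ball V r₀, c * ‖β - V‖ ^ 2 ≤ g V - g β) ∧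
      ContinuousOn g (Metric.ball V r₀) ∧
      ∀ r ∈ Set.Ioc 0 r₀, ∀ Φ : (Fin d → ℝ) → ℝ, Continuous Φ →
        Tendsto (fun s : ℝ => s ^ (-((d : ℝ) / 2)) *
          ∫ β in Metric.ball V r ∩ {β | g V - s ≤ g β}, Φ β) (𝓝[>] 0)
          (𝓝 ((2 * Real.pi) ^ ((d : ℝ) / 2) / Real.Gamma (((d : ℝ) + 2) / 2) *
            (1 / √(-hessianMatrix g V).det * Φ V))) := by
  obtain ⟨B, hB, hBdet, hlo⟩ := exists_neg_hessianMatrix_eq hg hmax hdet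
  obtain ⟨c, hc, hcB⟩ := exists_pos_mul_norm_sq_le B hB
  set Q : (Fin d → ℝ) → ℝ := fun z => ∑ i, (B *ᵥ z) i ^ 2 with hQ
  have hQs : ∀ (a : ℝ) z, Q (a • z) = a ^ 2 * Q z := by
    intro a z
    simp [hQ, Matrix.mulVec_smul, mul_pow, Finset.mul_sum]
  have hQc : Continuous Q := continuous_finsetSum _ fun i _ => ((continuous_apply i).comp
        (continuous_const.matrix_mulVec continuous_id)).pow 2
  obtain ⟨r1, hr1, hball1⟩ := Metric.eventually_nhds_iff_ball.1
    (hlo.def (show 0 < c / 4 by positivity))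
  obtain ⟨r2, hr2, hball2⟩ := Metric.eventually_nhds_iff_ball.1 (hg.eventually (by simp))
  have hgcont : ContinuousOn g (Metric.ball V (min r1 r2)) := fun β hβ =>
    (hball2 β (Metric.ball_subset_ball (min_le_right _ _) hβ)).continuousAt.continuousWithinAt
  -- The quadratic term is at least `c/2 ‖β - V‖²`, and the Taylor error takes away at most `c/4 ‖β
  -- - V‖²`.
  have hdecay : ∀ β ∈ Metric.ball V (min r1 r2), c / 4 * ‖β - V‖ ^ 2 ≤ g V - g β := by
    intro β hβ
    have hz : β - V ∈ Metric.ball (0 : Fin d → ℝ) r1 := by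
      rw [mem_ball_zero_iff, ← dist_eq_norm]
      exact (Metric.mem_ball.1 hβ).trans_le (min_le_left _ _)
    have h1 := hball1 _ hz
    rw [add_sub_cancel, Real.norm_eq_abs, Real.norm_of_nonneg (sq_nonneg _)] at h1
    have h2 := (abs_le.1 h1).1
    have h3 := hcB (β - V)
    linarith
  refine ⟨min r1 r2, lt_min hr1 hr2, c / 4, by positivity, hdecay, hgcont, ?_⟩
  rintro r ⟨hr, hrle⟩ Φ hΦ
  have hsubball : Metric.ball V r ⊆ Metric.ball V (min r1 r2) := Metric.ball_subset_ball hrle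
  set D : ℝ → Set (Fin d → ℝ) := fun s => Metric.ball V r ∩ {β | g V - s ≤ g β} with hD
  have hDm : ∀ s, MeasurableSet (D s) := fun s =>
    measurableSet_ball_inter_le (hgcont.mono hsubball) _
  set F : ℝ → (Fin d → ℝ) → ℝ := fun s y => (D s).indicator Φ (V + √s • y) with hF
  -- Substituting `β = V + √s y` produces the Jacobian `s ^ (d/2)`, which the prefactor cancels.
  have hscale : ∀ s > 0, s ^ (-((d : ℝ) / 2)) * ∫ β in D s, Φ β = ∫ y, F s y := by
    intro s hs
    have h1 := Measure.integral_comp_smul_of_nonneg (volume : Measure (Fin d → ℝ))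
      (fun z => (D s).indicator Φ (V + z)) (√s) (hR := Real.sqrt_nonneg s)
    rw [hF]
    dsimp only
    rw [h1, integral_add_left_eq_self (μ := volume) (fun β => (D s).indicator Φ β) V,
      integral_indicator (hDm s), smul_eq_mul]
    congr 1
    rw [Real.rpow_neg hs.le, Module.finrank_fin_fun, Real.sqrt_eq_rpow, ← Real.rpow_natCast,
      ← Real.rpow_mul hs.le]
    congr 2
    ring
  obtain ⟨C, hC⟩ := (isCompact_closedBall V r).exists_bound_of_continuousOn hΦ.continuousOn
  have hC0 : 0 ≤ C := (norm_nonneg _).trans (hC V (Metric.mem_closedBall_self hr.le))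
  have hlim : Tendsto (fun s => ∫ y, F s y) (𝓝[>] 0)
      (𝓝 (∫ y, {y | Q y ≤ 2}.indicator (fun _ => Φ V) y)) := by
    -- By the quadratic decay the rescaled sets all lie in the ball of radius `√(4/c)`. The
    -- indicators converge wherever `Q y ≠ 2`, hence almost everywhere.
    refine tendsto_integral_filter_of_dominated_convergence
      ((Metric.closedBall 0 (√(4 / c))).indicator fun _ => C) ?_ ?_ ?_ ?_
    · refine .of_forall fun s => ((hΦ.measurable.indicator (hDm s)).comp ?_).aestronglyMeasurable
      exact (measurable_const_add V).comp (measurable_const_smul _)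
    · filter_upwards [self_mem_nhdsWithin] with s hs
      have hs : 0 < s := hs
      refine ae_of_all _ fun y => ?_
      by_cases hy : V + √s • y ∈ D s
      · have h1 := hdecay _ (hsubball hy.1)
        have h2 : g V - s ≤ g (V + √s • y) := hy.2
        rw [add_sub_cancel_left, norm_smul, Real.norm_of_nonneg (Real.sqrt_nonneg _), mul_pow,
          Real.sq_sqrt hs.le] at h1
        have h3 : ‖y‖ ^ 2 ≤ 4 / c := by
          rw [le_div_iff₀ hc]
          have : s * (‖y‖ ^ 2 * c) ≤ s * 4 := by linarith
          exact le_of_mul_le_mul_left this hs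
        have h4 : y ∈ Metric.closedBall (0 : Fin d → ℝ) (√(4 / c)) := by
          rw [mem_closedBall_zero_iff]
          exact Real.le_sqrt_of_sq_le h3
        rw [hF]
        dsimp only
        rw [Set.indicator_of_mem hy, Set.indicator_of_mem h4]
        exact hC _ (Metric.ball_subset_closedBall hy.1)
      · rw [hF]
        dsimp only
        rw [Set.indicator_of_notMem hy, norm_zero]
        exact Set.indicator_nonneg (fun _ _ => hC0) _
    · exact (integrable_indicator_iff Metric.isClosed_closedBall.measurableSet).2
        (integrableOn_const (measure_closedBall_lt_top).ne)
    · have hnull := (volume_sum_mulVec_sq hd B hB).2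
      have hae : ∀ᵐ y : Fin d → ℝ, Q y ≠ 2 := by
        simpa only [ae_iff, not_not, ne_eq] using hnull
      filter_upwards [hae] with y hy
      have hz : Tendsto (fun s : ℝ => √s • y) (𝓝[>] 0) (𝓝 0) := by
        have : Continuous fun s : ℝ => √s • y := by fun_prop
        simpa using (this.tendsto 0).mono_left nhdsWithin_le_nhds
      have hVz : Tendsto (fun s : ℝ => V + √s • y) (𝓝[>] 0) (𝓝 V) := by
        simpa using hz.const_add V
      have hratio : Tendsto (fun s : ℝ => (g V - g (V + √s • y)) / s) (𝓝[>] 0)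
          (𝓝 (1 / 2 * Q y)) := by
        have h1 : (fun s : ℝ => g V - g (V + √s • y) - 1 / 2 * Q (√s • y)) =o[𝓝[>] 0]
            fun s : ℝ => s := by
          refine (hlo.comp_tendsto hz).trans_isBigO ?_
          refine Asymptotics.IsBigO.of_bound (‖y‖ ^ 2) ?_
          filter_upwards [self_mem_nhdsWithin] with s hs
          have hs : 0 < s := hs
          simp only [Function.comp, norm_smul, Real.norm_eq_abs, abs_of_nonneg (Real.sqrt_nonneg s),
            mul_pow, Real.sq_sqrt hs.le]
          rw [abs_of_nonneg (by positivity), abs_of_pos hs, mul_comm]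
        have h2 := h1.tendsto_div_nhds_zero.add_const (1 / 2 * Q y)
        rw [zero_add] at h2
        refine h2.congr' ?_
        filter_upwards [self_mem_nhdsWithin] with s hs
        have hs : 0 < s := hs
        rw [hQs, Real.sq_sqrt hs.le]
        field_simp
        ring
      have hballev : ∀ᶠ s : ℝ in 𝓝[>] 0, V + √s • y ∈ Metric.ball V r :=
        hVz.eventually (Metric.ball_mem_nhds V hr)
      rcases lt_or_gt_of_ne hy with hlt | hgt
      · rw [Set.indicator_of_mem (show y ∈ {y | Q y ≤ 2} from hlt.le)]
        refine ((hΦ.tendsto V).comp hVz).congr' ?_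
        filter_upwards [hballev, hratio.eventually (gt_mem_nhds (show 1 / 2 * Q y < 1 by linarith)),
          self_mem_nhdsWithin] with s h1 h2 hs
        have hs : 0 < s := hs
        rw [div_lt_one hs] at h2
        have : V + √s • y ∈ D s := ⟨h1, by rw [Set.mem_ofPred_eq]; linarith⟩
        rw [hF]
        exact (Set.indicator_of_mem this Φ).symm
      · rw [Set.indicator_of_notMem (show y ∉ {y | Q y ≤ 2} from not_le.2 hgt)]
        refine tendsto_const_nhds.congr' ?_
        filter_upwards [hratio.eventually (lt_mem_nhds (show 1 < 1 / 2 * Q y by linarith)),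
          self_mem_nhdsWithin] with s h2 hs
        have hs : 0 < s := hs
        rw [one_lt_div hs] at h2
        have : V + √s • y ∉ D s := fun h => by
          have := h.2
          rw [Set.mem_ofPred_eq] at this
          linarith
        rw [hF]
        exact (Set.indicator_of_notMem this Φ).symm
  have hval : ∫ y, {y | Q y ≤ 2}.indicator (fun _ => Φ V) y =
      (2 * Real.pi) ^ ((d : ℝ) / 2) / Real.Gamma (((d : ℝ) + 2) / 2) *
            (1 / √(-hessianMatrix g V).det * Φ V) := by
    rw [integral_indicator (measurableSet_le hQc.measurable measurable_const), setIntegral_const,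
      (volume_sum_mulVec_sq hd B hB).1, hBdet, smul_eq_mul]
    ring
  rw [hval] at hlim
  refine hlim.congr' ?_
  filter_upwards [self_mem_nhdsWithin] with s hs
  exact (hscale s hs).symm

end Laplace

/-! ### Products of measures with densities. -/

section ProductDensity

lemma pi_withDensity_ofReal {X ι : Type*} [MeasurableSpace X] [Fintype ι] (ρ : Measure X)
    [SigmaFinite ρ] {w : X → ℝ} (hw0 : ∀ x, 0 ≤ w x) (hw : Integrable w ρ) :
    Measure.pi (fun _ : ι => ρ.withDensity fun x => ENNReal.ofReal (w x)) =
      (Measure.pi fun _ : ι => ρ).withDensity fun x => ENNReal.ofReal (∏ i, w (x i)) := by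
  have hfin : IsFiniteMeasure (ρ.withDensity fun x => ENNReal.ofReal (w x)) :=
    isFiniteMeasure_withDensity_ofReal hw.2
  refine Measure.pi_eq fun s hs => ?_
  have h1 : ∀ i, (ρ.withDensity fun x => ENNReal.ofReal (w x)) (s i) =
      ENNReal.ofReal (∫ x in s i, w x ∂ρ) := fun i => by
    rw [withDensity_apply _ (hs i),
      ofReal_integral_eq_lintegral_ofReal hw.integrableOn (ae_of_all _ hw0)]
  simp only [h1]
  rw [withDensity_apply _ (MeasurableSet.univ_pi hs), Measure.restrict_pi_pi,
    ← ENNReal.ofReal_prod_of_nonneg (fun i _ => integral_nonneg hw0),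
    ← integral_fintype_prod_eq_prod, ofReal_integral_eq_lintegral_ofReal]
  · exact Integrable.fintype_prod fun i => hw.integrableOn
  · exact ae_of_all _ fun x => Finset.prod_nonneg fun i _ => hw0 _

end ProductDensity

/-! ### Angles on the circle. -/

section CircleAngle

/-- The angle of a point of the unit circle, in `[0, 2π)`. -/
noncomputable def circleAngle (z : Circle) : ℝ :=
  if 0 ≤ Complex.arg z then Complex.arg z else Complex.arg z + 2 * Real.pi

lemma measurable_circleAngle : Measurable circleAngle := by
  have h : Measurable fun z : Circle => Complex.arg z :=
    Complex.measurable_arg.comp (show Continuous fun z : Circle => (z : ℂ) by fun_prop).measurable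
  exact Measurable.ite (measurableSet_le measurable_const h) h (h.add_const _)

lemma circleAngle_mem_Ico (z : Circle) : circleAngle z ∈ Set.Ico 0 (2 * Real.pi) := by
  have h1 := Complex.neg_pi_lt_arg (z : ℂ)
  have h2 := Complex.arg_le_pi (z : ℂ)
  have h3 := Real.pi_pos
  unfold circleAngle
  split_ifs with h <;> constructor <;> linarith

@[simp]
lemma exp_circleAngle (z : Circle) : Circle.exp (circleAngle z) = z := by
  unfold circleAngle
  split_ifs with h
  · exact Circle.exp_arg z
  · rw [Circle.exp_add_two_pi, Circle.exp_arg]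

lemma circleAngle_exp {β : ℝ} (hβ : β ∈ Set.Ico 0 (2 * Real.pi)) :
    circleAngle (Circle.exp β) = β :=
  Circle.exp_injOn_Ico (by simp) (circleAngle_mem_Ico _) hβ (exp_circleAngle _)

/-- The angles from the first point to the others. -/
noncomputable def relAngles {d : ℕ} (x : Fin (d + 1) → Circle) : Fin d → ℝ :=
  fun j => circleAngle (x j.succ / x 0)

lemma measurable_relAngles {d : ℕ} : Measurable (relAngles (d := d)) :=
  measurable_pi_lambda _ fun j => measurable_circleAngle.comp
    ((measurable_pi_apply j.succ).div (measurable_pi_apply 0))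

lemma relAngles_mem {d : ℕ} (x : Fin (d + 1) → Circle) :
    relAngles x ∈ Set.univ.pi fun _ : Fin d => Set.Ico 0 (2 * Real.pi) :=
  fun _ _ => circleAngle_mem_Ico _

end CircleAngle

/-! ### The law of the central angles. -/

section CircleLaw

variable {p : ℝ → ℝ}

lemma IsCircleDensity.integrableOn (hp : IsCircleDensity p) (x : ℝ) :
    Integrable (fun β => p (x + β)) (volume.restrict (Set.Ico 0 (2 * Real.pi))) :=
  ((hp.continuous.comp (continuous_const_add x)).continuousOn.integrableOn_Icc).mono_set
    Set.Ico_subset_Icc_self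

lemma IsCircleDensity.exists_bound (hp : IsCircleDensity p) : ∃ C > 0, ∀ x, p x ≤ C := by
  obtain ⟨C, hC⟩ := (isCompact_Icc (a := (0 : ℝ)) (b := 2 * Real.pi)).exists_bound_of_continuousOn
    hp.continuous.continuousOn
  refine ⟨max C 1, by positivity, fun x => ?_⟩
  obtain ⟨y, hy, hxy⟩ := hp.periodic.exists_mem_Ico₀ Real.two_pi_pos x
  rw [hxy]
  exact (le_abs_self _).trans ((hC y (Set.Ico_subset_Icc_self hy)).trans (le_max_left _ _))

/-- The law of a random point, seen from the point `exp x`. -/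
lemma circleLaw_eq_map (hp : IsCircleDensity p) (x : ℝ) :
    circleLaw p = ((volume.restrict (Set.Ico 0 (2 * Real.pi))).withDensity
      fun β => ENNReal.ofReal (p (x + β))).map fun β => Circle.exp x * Circle.exp β := by
  have hm : Measurable fun β : ℝ => Circle.exp β := Circle.exp.continuous.measurable
  ext s hs
  rw [circleLaw, Measure.map_apply hm hs, Measure.map_apply (hm.const_mul _) hs,
    withDensity_apply _ (hm hs), withDensity_apply _ (hm.const_mul _ hs)]
  set G : ℝ → ENNReal := ((fun β : ℝ => Circle.exp β) ⁻¹' s).indicator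
    fun β => ENNReal.ofReal (p β) with hG
  have hGp : Function.Periodic G (2 * Real.pi) := by
    intro β
    have h : β + 2 * Real.pi ∈ (fun β : ℝ => Circle.exp β) ⁻¹' s ↔
        β ∈ (fun β : ℝ => Circle.exp β) ⁻¹' s := by
      rw [Set.mem_preimage, Set.mem_preimage, Circle.exp_add_two_pi]
    by_cases hb : β ∈ (fun β : ℝ => Circle.exp β) ⁻¹' s
    · rw [hG, Set.indicator_of_mem hb, Set.indicator_of_mem (h.2 hb), hp.periodic β]
    · rw [hG, Set.indicator_of_notMem hb, Set.indicator_of_notMem (mt h.1 hb)]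
  rw [← lintegral_indicator (hm hs), ← lintegral_indicator (hm.const_mul _ hs)]
  have h1 : ∀ β, ((fun β : ℝ => Circle.exp x * Circle.exp β) ⁻¹' s).indicator
      (fun β => ENNReal.ofReal (p (x + β))) β = G (x + β) := by
    intro β
    have h : β ∈ (fun β : ℝ => Circle.exp x * Circle.exp β) ⁻¹' s ↔
        x + β ∈ (fun β : ℝ => Circle.exp β) ⁻¹' s := by
      rw [Set.mem_preimage, Set.mem_preimage, Circle.exp_add]
    by_cases hb : β ∈ (fun β : ℝ => Circle.exp x * Circle.exp β) ⁻¹' s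
    · rw [hG, Set.indicator_of_mem hb, Set.indicator_of_mem (h.1 hb)]
    · rw [hG, Set.indicator_of_notMem hb, Set.indicator_of_notMem (mt h.2 hb)]
  simp only [h1]
  have hinv : VAddInvariantMeasure (AddSubgroup.zmultiples (2 * Real.pi)) ℝ volume :=
    ⟨fun c s _ => measure_preimage_add _ _ _⟩
  -- A `2π`-periodic function has the same integral over `(0, 2π]` and over `(x, x + 2π]`.
  have h2 := IsAddFundamentalDomain.setLIntegral_eq (G := AddSubgroup.zmultiples (2 * Real.pi))
    (isAddFundamentalDomain_Ioc Real.two_pi_pos 0) (isAddFundamentalDomain_Ioc Real.two_pi_pos x)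
    G hGp.map_vadd_zmultiples
  rw [restrict_Ico_eq_restrict_Ioc]
  rw [zero_add] at h2
  rw [h2, ← lintegral_indicator measurableSet_Ioc, ← lintegral_indicator measurableSet_Ioc,
    ← lintegral_add_left_eq_self (μ := volume) _ x]
  refine lintegral_congr fun β => ?_
  simp only [Set.indicator, Set.mem_Ioc, lt_add_iff_pos_right, add_le_add_iff_left]

lemma isProbabilityMeasure_circleLaw (hp : IsCircleDensity p) :
    IsProbabilityMeasure (circleLaw p) := by
  refine ⟨?_⟩
  have hi := hp.integrableOn 0
  simp only [zero_add] at hi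
  rw [circleLaw, Measure.map_apply Circle.exp.continuous.measurable MeasurableSet.univ,
    Set.preimage_univ, withDensity_apply _ MeasurableSet.univ, Measure.restrict_univ,
    ← ofReal_integral_eq_lintegral_ofReal hi (ae_of_all _ hp.nonneg), restrict_Ico_eq_restrict_Ioc,
    ← intervalIntegral.integral_of_le Real.two_pi_pos.le, hp.integral_eq_one, ENNReal.ofReal_one]

/-- Seen from `u`, the angle of a random point has the shifted density, still at most `C`. The bound
is therefore uniform in `u`, as the star estimate requires. -/
lemma circleLaw_angle_le (hp : IsCircleDensity p) {C : ℝ} (hC : ∀ x, p x ≤ C) (u : Circle)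
    {T : Set ℝ} (hT : MeasurableSet T) :
    circleLaw p {v | circleAngle (v / u) ∈ T} ≤ ENNReal.ofReal C * volume T := by
  have hset : MeasurableSet {v | circleAngle (v / u) ∈ T} :=
    hT.preimage (measurable_circleAngle.comp (measurable_id.div_const u))
  have hm : Measurable fun β : ℝ => Circle.exp (circleAngle u) * Circle.exp β :=
    Circle.exp.continuous.measurable.const_mul _
  rw [circleLaw_eq_map hp (circleAngle u), Measure.map_apply hm hset,
    withDensity_apply _ (hm hset)]
  calc _ ≤ ∫⁻ _ in (fun β : ℝ => Circle.exp (circleAngle u) * Circle.exp β) ⁻¹'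
        {v | circleAngle (v / u) ∈ T}, ENNReal.ofReal C
          ∂(volume.restrict (Set.Ico 0 (2 * Real.pi))) :=
        lintegral_mono fun β => ENNReal.ofReal_le_ofReal (hC _)
    _ ≤ _ := by
        rw [setLIntegral_const, Measure.restrict_apply (hm hset)]
        gcongr
        rintro β ⟨h1, h2⟩
        simpa [circleAngle_exp h2] using h1

lemma configIntegral_nonneg (hp : IsCircleDensity p) {d : ℕ} (β : Fin d → ℝ) :
    0 ≤ configIntegral p β :=
  intervalIntegral.integral_nonneg Real.two_pi_pos.le fun x _ =>
    mul_nonneg (hp.nonneg x) (Finset.prod_nonneg fun _ _ => hp.nonneg _)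

lemma continuous_configIntegral (hp : IsCircleDensity p) {d : ℕ} :
    Continuous (configIntegral p : (Fin d → ℝ) → ℝ) := by
  have hc := hp.continuous
  refine intervalIntegral.continuous_parametric_intervalIntegral_of_continuous'
    (f := fun (β : Fin d → ℝ) x => p x * ∏ l, p (x + β l)) ?_ _ _
  unfold Function.uncurry
  fun_prop

/-- The probability that the central angles of `d + 1` random points lie in `D`. -/
theorem pi_circleLaw_relAngles (hp : IsCircleDensity p) {d : ℕ} {D : Set (Fin d → ℝ)}
    (hD : MeasurableSet D) (hDI : D ⊆ Set.univ.pi fun _ : Fin d => Set.Ico 0 (2 * Real.pi)) :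
    (Measure.pi fun _ : Fin (d + 1) => circleLaw p).real {x | relAngles x ∈ D} =
      ∫ β in D, configIntegral p β := by
  have := isProbabilityMeasure_circleLaw hp
  have hA : MeasurableSet {x : Fin (d + 1) → Circle | relAngles x ∈ D} :=
    hD.preimage measurable_relAngles
  have hc := hp.continuous
  have hexp : Measurable fun β : ℝ => Circle.exp β := Circle.exp.continuous.measurable
  set I : Measure ℝ := volume.restrict (Set.Ico 0 (2 * Real.pi)) with hI
  set w : ℝ → (Fin d → ℝ) → ENNReal := fun x β => ENNReal.ofReal (∏ l, p (x + β l)) with hw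
  have hcons : Measurable fun z : Circle × (Fin d → Circle) =>
      (Fin.cons z.1 z.2 : Fin (d + 1) → Circle) := by
    refine measurable_pi_lambda _ fun j => ?_
    refine Fin.cases ?_ (fun k => ?_) j
    · simpa using measurable_fst
    · exact (measurable_pi_apply k).comp measurable_snd
  have h1 : (Measure.pi fun _ : Fin (d + 1) => circleLaw p) {x | relAngles x ∈ D} =
      ∫⁻ u, (Measure.pi fun _ : Fin d => circleLaw p)
        {v | relAngles (Fin.cons u v : Fin (d + 1) → Circle) ∈ D} ∂circleLaw p := by
    have hmp := (measurePreserving_piFinSuccAbove (fun _ : Fin (d + 1) => circleLaw p) 0).symm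
    rw [← hmp.measure_preimage hA.nullMeasurableSet, Measure.prod_apply (hmp.measurable hA)]
    refine lintegral_congr fun u => ?_
    congr 1
  -- With the first point fixed at `exp x`, the law of the others is written in angles measured from
  -- it; on the half-open cube `relAngles` recovers exactly these angles.
  have h2 : ∀ x : ℝ, (Measure.pi fun _ : Fin d => circleLaw p)
      {v | relAngles (Fin.cons (Circle.exp x) v : Fin (d + 1) → Circle) ∈ D} =
      ∫⁻ β in D, w x β := by
    intro x
    have hmf : Measurable fun β : ℝ => Circle.exp x * Circle.exp β := hexp.const_mul _
    have hfin : IsFiniteMeasure (I.withDensity fun β => ENNReal.ofReal (p (x + β))) :=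
      isFiniteMeasure_withDensity_ofReal (hp.integrableOn x).2
    have hmset : MeasurableSet
        {v | relAngles (Fin.cons (Circle.exp x) v : Fin (d + 1) → Circle) ∈ D} :=
      hA.preimage (hcons.comp (measurable_const.prodMk measurable_id))
    have hmm : Measurable fun (β : Fin d → ℝ) i => Circle.exp x * Circle.exp (β i) :=
      measurable_pi_lambda _ fun i => hmf.comp (measurable_pi_apply i)
    rw [circleLaw_eq_map hp x, ← hI, ← Measure.pi_map_pi fun _ => hmf.aemeasurable,
      Measure.map_apply hmm hmset, pi_withDensity_ofReal I (w := fun β => p (x + β))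
        (fun _ => hp.nonneg _) (hp.integrableOn x), withDensity_apply _ (hmm hmset), hI,
      ← Measure.restrict_pi_pi, ← volume_pi, Measure.restrict_restrict (hmm hmset)]
    congr 2
    ext β
    have hrel : ∀ β ∈ Set.univ.pi fun _ : Fin d => Set.Ico 0 (2 * Real.pi),
        relAngles (Fin.cons (Circle.exp x) fun i => Circle.exp x * Circle.exp (β i) :
          Fin (d + 1) → Circle) = β := by
      intro β hβ
      ext j
      simp [relAngles, circleAngle_exp (hβ j trivial)]
    constructor
    · rintro ⟨h, hβ⟩
      have h' : relAngles (Fin.cons (Circle.exp x) fun i => Circle.exp x * Circle.exp (β i) :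
          Fin (d + 1) → Circle) ∈ D := h
      rwa [hrel β hβ] at h'
    · intro h
      refine ⟨?_, hDI h⟩
      change relAngles (Fin.cons (Circle.exp x) fun i => Circle.exp x * Circle.exp (β i) :
          Fin (d + 1) → Circle) ∈ D
      rwa [hrel β (hDI h)]
  have hmeas : Measurable fun u => (Measure.pi fun _ : Fin d => circleLaw p)
        {v | relAngles (Fin.cons u v : Fin (d + 1) → Circle) ∈ D} :=
    measurable_measure_prodMk_left (hA.preimage hcons)
  have hpm : Measurable fun x => ENNReal.ofReal (p x) := hc.measurable.ennreal_ofReal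
  have h3 : (Measure.pi fun _ : Fin (d + 1) => circleLaw p) {x | relAngles x ∈ D} =
      ∫⁻ β in D, ENNReal.ofReal (configIntegral p β) := by
    have hwm : Measurable fun z : ℝ × (Fin d → ℝ) => ENNReal.ofReal (p z.1) * w z.1 z.2 := by
      refine (hpm.comp measurable_fst).mul (Measurable.ennreal_ofReal ?_)
      exact Continuous.measurable (by fun_prop)
    calc (Measure.pi fun _ : Fin (d + 1) => circleLaw p) {x | relAngles x ∈ D}
        = ∫⁻ x, ENNReal.ofReal (p x) * (∫⁻ β in D, w x β) ∂I := by
          rw [h1, circleLaw, lintegral_map (by simpa only [circleLaw] using hmeas) hexp,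
            lintegral_withDensity_eq_lintegral_mul _ hpm
              (by simpa only [circleLaw, Function.comp_def] using hmeas.comp hexp)]
          refine lintegral_congr fun x => ?_
          rw [Pi.mul_apply, ← h2 x]
          rfl
      _ = ∫⁻ x, ∫⁻ β in D, ENNReal.ofReal (p x) * w x β ∂volume ∂I := by
          refine lintegral_congr fun x => ?_
          rw [lintegral_const_mul' _ _ ENNReal.ofReal_ne_top]
      _ = ∫⁻ β in D, ∫⁻ x, ENNReal.ofReal (p x) * w x β ∂I :=
          lintegral_lintegral_swap hwm.aemeasurable
      _ = ∫⁻ β in D, ENNReal.ofReal (configIntegral p β) := by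
          refine lintegral_congr fun β => ?_
          have hcont : Continuous fun x => p x * ∏ l, p (x + β l) := by fun_prop
          rw [configIntegral, intervalIntegral.integral_of_le Real.two_pi_pos.le,
            ← restrict_Ico_eq_restrict_Ioc, ofReal_integral_eq_lintegral_ofReal
              (hcont.continuousOn.integrableOn_Icc.mono_set Set.Ico_subset_Icc_self)
              (ae_of_all _ fun x => mul_nonneg (hp.nonneg x)
                (Finset.prod_nonneg fun _ _ => hp.nonneg _))]
          refine lintegral_congr fun x => ?_
          rw [ENNReal.ofReal_mul (hp.nonneg x)]
  rw [measureReal_def, h3, integral_eq_lintegral_of_nonneg_ae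
    (ae_of_all _ fun β => configIntegral_nonneg hp β)
    (continuous_configIntegral hp).aestronglyMeasurable]

end CircleLaw

/-! ### Symmetry of the maximum points and global Laplace asymptotics. -/

section Kernel

/-- The half-open cube of central angles. -/
def icoCube (d : ℕ) : Set (Fin d → ℝ) := Set.univ.pi fun _ => Set.Ico 0 (2 * Real.pi)

lemma icoCube_subset_angleCube (d : ℕ) : icoCube d ⊆ angleCube d :=
  Set.pi_mono fun _ _ => Set.Ico_subset_Icc_self

/-- The angles at which `h` is at least `M - s`. -/
def superlevel {d : ℕ} (h : (Fin d → ℝ) → EReal) (M s : ℝ) : Set (Fin d → ℝ) :=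
  {β | β ∈ icoCube d ∧ ((M - s : ℝ) : EReal) ≤ h β}

variable {d : ℕ} {f : (Fin (d + 1) → Circle) → EReal} {h : (Fin d → ℝ) → EReal} {M : ℝ}

namespace KernelConditions

lemma measurableSet_superlevel (hA : KernelConditions f h M) (s : ℝ) :
    MeasurableSet (superlevel h M s) := by
  obtain ⟨u, hu, hu'⟩ := continuousOn_iff_isClosed.1 hA.continuous
    (Set.Ici ((M - s : ℝ) : EReal)) isClosed_Ici
  have hcube : IsClosed (angleCube d) := isClosed_set_pi fun _ _ => isClosed_Icc
  have hEq : superlevel h M s = (u ∩ angleCube d) ∩ icoCube d := by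
    rw [← hu']
    ext β
    constructor
    · rintro ⟨h1, h2⟩
      exact ⟨⟨h2, icoCube_subset_angleCube d h1⟩, h1⟩
    · rintro ⟨⟨h2, -⟩, h1⟩
      exact ⟨h1, h2⟩
  rw [hEq]
  exact (hu.inter hcube).measurableSet.inter (MeasurableSet.univ_pi fun _ => measurableSet_Ico)

lemma eq_relAngles (hA : KernelConditions f h M) (x : Fin (d + 1) → Circle) :
    f x = h (relAngles x) := by
  rw [← hA.rotation_invariant (x 0) (relAngles x) fun j => circleAngle_mem_Ico _]
  congr 1
  ext j
  refine Fin.cases ?_ (fun k => ?_) j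
  · simp
  · simp [relAngles]

lemma le_iff_relAngles_mem (hA : KernelConditions f h M) (s : ℝ) (x : Fin (d + 1) → Circle) :
    ((M - s : ℝ) : EReal) ≤ f x ↔ relAngles x ∈ superlevel h M s := by
  rw [hA.eq_relAngles]
  exact ⟨fun hx => ⟨relAngles_mem x, hx⟩, fun hx => hx.2⟩

lemma le_max (hA : KernelConditions f h M) {β : Fin d → ℝ} (hβ : β ∈ angleCube d) :
    h β ≤ M := hA.max_value.2 ⟨β, hβ, rfl⟩

lemma maxPoint_mem_icoCube (hA : KernelConditions f h M) {V : Fin d → ℝ}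
    (hV : V ∈ maxPoints h M) : V ∈ icoCube d :=
  fun j _ => Set.Ioo_subset_Ico_self (hA.maxPoints_interior V hV j)

/-- The coordinates of a maximum point are pairwise distinct. -/
lemma injective_of_mem_maxPoints (hA : KernelConditions f h M) {V : Fin d → ℝ}
    (hV : V ∈ maxPoints h M) : Function.Injective V := by
  intro i j hij
  by_contra hne
  set x : Fin (d + 1) → Circle := Fin.cons 1 fun k => 1 * Circle.exp (V k) with hx
  have hfx : f x = M := by
    rw [hx, hA.rotation_invariant 1 V fun k => hA.maxPoint_mem_icoCube hV k trivial]
    exact hV.2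
  -- If coordinates `i` and `j` agree, taking point `i.succ` as base puts point `j.succ` at angle
  -- `0`: a maximum point on the boundary of the cube.
  set σ : Equiv.Perm (Fin (d + 1)) := Equiv.swap 0 i.succ
  have hσ : h (relAngles (x ∘ σ)) = M := by
    rw [← hA.eq_relAngles, hA.symmetric, hfx]
  have hmem : relAngles (x ∘ σ) ∈ maxPoints h M :=
    ⟨icoCube_subset_angleCube d (relAngles_mem _), hσ⟩
  have h0 := (hA.maxPoints_interior _ hmem j).1
  have h1 : σ j.succ = j.succ := Equiv.swap_apply_of_ne_of_ne (Fin.succ_ne_zero j)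
    fun he => hne (Fin.succ_injective _ he).symm
  have h2 : σ 0 = i.succ := Equiv.swap_apply_left _ _
  have h3 : relAngles (x ∘ σ) j = 0 := by
    simp only [relAngles, Function.comp, h1, h2]
    have : x j.succ = x i.succ := by simp [hx, hij]
    rw [this, div_self', ← Circle.exp_zero, circleAngle_exp ⟨le_rfl, Real.two_pi_pos⟩]
  rw [h3] at h0
  exact lt_irrefl _ h0

/-- Permuting the angles permutes the points while fixing the first. The half-open cube is needed
because only there does `h` express `f`. -/
lemma comp_perm (hA : KernelConditions f h M) (σ : Equiv.Perm (Fin d)) {β : Fin d → ℝ}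
    (hβ : β ∈ icoCube d) : h (β ∘ σ) = h β := by
  rw [← hA.rotation_invariant 1 β fun j => hβ j trivial,
    ← hA.rotation_invariant 1 (β ∘ σ) fun j => hβ (σ j) trivial,
    ← hA.symmetric (Equiv.Perm.decomposeFin.symm (0, σ))
      (Fin.cons 1 fun j => 1 * Circle.exp (β j))]
  congr 1
  ext j
  refine Fin.cases ?_ (fun k => ?_) j
  · simp
  · simp [Equiv.Perm.decomposeFin_symm_apply_succ]

lemma comp_perm_mem_maxPoints (hA : KernelConditions f h M) (σ : Equiv.Perm (Fin d))
    {V : Fin d → ℝ} (hV : V ∈ maxPoints h M) : V ∘ σ ∈ maxPoints h M :=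
  ⟨fun j _ => hV.1 (σ j) trivial, by rw [hA.comp_perm σ (hA.maxPoint_mem_icoCube hV)]; exact hV.2⟩

lemma icoCube_mem_nhds (hA : KernelConditions f h M) {V : Fin d → ℝ}
    (hV : V ∈ maxPoints h M) : icoCube d ∈ 𝓝 V :=
  set_pi_mem_nhds Set.finite_univ fun j _ => Ico_mem_nhds (hA.maxPoints_interior V hV j).1
    (hA.maxPoints_interior V hV j).2

/-- Near the interior point `V` the function is invariant under permuting coordinates, so by the
chain rule the two Hessians differ by a simultaneous permutation of rows and columns. -/
lemma det_hessianMatrix_comp_perm (hA : KernelConditions f h M) (σ : Equiv.Perm (Fin d))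
    {V : Fin d → ℝ} (hV : V ∈ maxPoints h M) :
    (-hessianMatrix (fun x => (h x).toReal) (V ∘ σ)).det =
      (-hessianMatrix (fun x => (h x).toReal) V).det := by
  set g : (Fin d → ℝ) → ℝ := fun x => (h x).toReal with hg
  set L : (Fin d → ℝ) ≃L[ℝ] (Fin d → ℝ) :=
    (LinearEquiv.funCongrLeft ℝ ℝ σ).toContinuousLinearEquiv with hL
  have hLapp : ∀ β, L β = β ∘ σ := fun β => rfl
  have hLs : ∀ b, L (Pi.single b 1) = Pi.single (σ.symm b) 1 := by
    intro b
    ext k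
    simp only [hLapp, Function.comp, Pi.single_apply, Equiv.eq_symm_apply]
  have hev : g ∘ L =ᶠ[𝓝 V] g := by
    filter_upwards [hA.icoCube_mem_nhds hV] with β hβ
    simp only [Function.comp, hLapp, hg, hA.comp_perm σ hβ]
  have hfd : fderiv ℝ g =ᶠ[𝓝 V] fun y => (fderiv ℝ g (L y)).comp (L : (Fin d → ℝ) →L[ℝ] _) := by
    filter_upwards [hev.eventually_nhds] with y hy
    have hy' : g ∘ L =ᶠ[𝓝 y] g := hy
    rw [← hy'.fderiv_eq, L.comp_right_fderiv]
  have hH : hessianMatrix g V = (hessianMatrix g (V ∘ σ)).submatrix σ.symm σ.symm := by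
    ext a b
    have h1 : (fun y => fderiv ℝ g y (Pi.single b 1)) =ᶠ[𝓝 V]
        (fun y => fderiv ℝ g y (Pi.single (σ.symm b) 1)) ∘ L := by
      filter_upwards [hfd] with y hy
      rw [hy]
      simp [hLs]
    simp only [hessianMatrix, Matrix.of_apply, Matrix.submatrix_apply]
    rw [h1.fderiv_eq, L.comp_right_fderiv]
    simp [hLs, hLapp]
  have hneg : -hessianMatrix g V = (-hessianMatrix g (V ∘ σ)).submatrix σ.symm σ.symm := by
    rw [hH]; rfl
  rw [hneg, Matrix.det_submatrix_equiv_self]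

end KernelConditions

lemma configIntegral_comp_perm (p : ℝ → ℝ) (V : Fin d → ℝ) (σ : Equiv.Perm (Fin d)) :
    configIntegral p (V ∘ σ) = configIntegral p V := by
  unfold configIntegral
  congr 1
  ext x
  rw [← Equiv.prod_comp σ (fun l => p (x + V l))]
  rfl

/-- A permutation-invariant sum over all maximum points, in terms of the ordered ones. -/
lemma KernelConditions.sum_maxPoints (hA : KernelConditions f h M) (T : (Fin d → ℝ) → ℝ)
    (hT : ∀ V ∈ maxPoints h M, ∀ σ : Equiv.Perm (Fin d), T (V ∘ σ) = T V) :
    ∑ V ∈ hA.finite_maxPoints.toFinset, T V =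
      (d.factorial : ℝ) * ∑ᶠ W ∈ orderedMaxPoints h M, T W := by
  classical
  have hfin : (orderedMaxPoints h M).Finite := hA.finite_maxPoints.subset fun V hV => hV.1
  rw [finsum_mem_eq_finite_toFinset_sum _ hfin]
  have hsum : ∑ V ∈ hA.finite_maxPoints.toFinset, T V =
      ∑ x ∈ hfin.toFinset ×ˢ (Finset.univ : Finset (Equiv.Perm (Fin d))), T x.1 := by
    symm
    -- Sorting inverts `(W, σ) ↦ W ∘ σ`. The permutation is recovered uniquely because the
    -- coordinates are distinct.
    refine Finset.sum_bij' (fun x _ => x.1 ∘ x.2)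
      (fun V _ => (V ∘ Tuple.sort V, (Tuple.sort V)⁻¹)) ?_ ?_ ?_ ?_ ?_
    · rintro ⟨W, σ⟩ hx
      have hW : W ∈ orderedMaxPoints h M := by simpa using hx
      simpa using hA.comp_perm_mem_maxPoints σ hW.1
    · intro V hV
      have hV' : V ∈ maxPoints h M := by simpa using hV
      have : V ∘ Tuple.sort V ∈ orderedMaxPoints h M :=
        ⟨hA.comp_perm_mem_maxPoints _ hV', Tuple.monotone_sort V⟩
      simpa using this
    · rintro ⟨W, σ⟩ hx
      have hW : W ∈ orderedMaxPoints h M := by simpa using hx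
      have hinj := hA.injective_of_mem_maxPoints hW.1
      have h1 : (W ∘ σ) ∘ Tuple.sort (W ∘ σ) = W := by
        rw [Tuple.comp_perm_comp_sort_eq_comp_sort, Tuple.sort_eq_refl_iff_monotone.2 hW.2]
        rfl
      have h2 : σ * Tuple.sort (W ∘ σ) = 1 := by
        ext k
        have := congrFun h1 k
        exact congrArg Fin.val (hinj this)
      refine Prod.ext h1 ?_
      exact (eq_inv_of_mul_eq_one_left h2).symm
    · intro V hV
      ext k
      simp
    · rintro ⟨W, σ⟩ hx
      have hW : W ∈ orderedMaxPoints h M := by simpa using hx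
      exact (hT W hW.1 σ).symm
  rw [hsum, Finset.sum_product, Finset.mul_sum]
  refine Finset.sum_congr rfl fun W _ => ?_
  change ∑ _σ : Equiv.Perm (Fin d), T W = _
  rw [Finset.sum_const, Finset.card_univ, Fintype.card_perm, Fintype.card_fin, nsmul_eq_mul]

/-- Global Laplace asymptotics of the superlevel sets, and their concentration near the
maximum points. -/
theorem KernelConditions.tendsto_superlevel (hA : KernelConditions f h M) (hd : 1 ≤ d) :
    (∀ Φ : (Fin d → ℝ) → ℝ, Continuous Φ →
      Tendsto (fun s : ℝ => s ^ (-((d : ℝ) / 2)) * ∫ β in superlevel h M s, Φ β) (𝓝[>] 0)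
        (𝓝 ((2 * Real.pi) ^ ((d : ℝ) / 2) / Real.Gamma (((d : ℝ) + 2) / 2) *
          ∑ V ∈ hA.finite_maxPoints.toFinset,
            1 / √(-hessianMatrix (fun x => (h x).toReal) V).det * Φ V))) ∧
    ∃ C > 0, ∀ᶠ s in 𝓝[>] (0 : ℝ), ∀ β ∈ superlevel h M s,
      ∃ V ∈ maxPoints h M, ‖β - V‖ ≤ C * √s := by
  set g : (Fin d → ℝ) → ℝ := fun x => (h x).toReal with hg
  set F := hA.finite_maxPoints.toFinset with hF
  have hFmem : ∀ V, V ∈ F ↔ V ∈ maxPoints h M := fun V => by simp [hF]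
  obtain ⟨δ, hδ, hsm⟩ := hA.smooth
  have hgV : ∀ V ∈ F, g V = M := fun V hV => by
    have := ((hFmem V).1 hV).2
    simp [hg, this]
  have hcd : ∀ V ∈ F, ContDiffAt ℝ 2 g V := fun V hV =>
    (((hsm V ((hFmem V).1 hV)).2.contDiffAt (Metric.ball_mem_nhds V hδ)).of_le (by norm_num))
  -- `toReal` sends infinite values to `0`, so both must be excluded: `⊥` by smoothness near `V`,
  -- `⊤` by the bound `M`, valid on the cube.
  have hcoe : ∀ V ∈ F, ∀ β ∈ Metric.ball V δ, β ∈ icoCube d → ((g β : ℝ) : EReal) = h β := by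
    intro V hV β hβ hβ'
    refine EReal.coe_toReal ?_ ((hsm V ((hFmem V).1 hV)).1 β hβ)
    exact ne_top_of_le_ne_top (EReal.coe_ne_top M) (hA.le_max (icoCube_subset_angleCube d hβ'))
  have hmax : ∀ V ∈ F, IsLocalMax g V := by
    intro V hV
    filter_upwards [Metric.ball_mem_nhds V hδ, hA.icoCube_mem_nhds ((hFmem V).1 hV)] with β h1 h2
    rw [hgV V hV, ← EReal.coe_le_coe_iff, hcoe V hV β h1 h2]
    exact hA.le_max (icoCube_subset_angleCube d h2)
  have hloc : ∀ V ∈ F, _ := fun V hV => tendsto_setIntegral_superlevel hd (hcd V hV) (hmax V hV)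
    (hA.nondegenerate V ((hFmem V).1 hV))
  choose! r₀ hr₀ c₀ hc₀ hdec hcont hlim using hloc
  obtain ⟨c, hcle, hc⟩ : ∃ c : ℝ, (∀ V ∈ F, c ≤ c₀ V) ∧ 0 < c := by
    have h1 : ∀ᶠ c : ℝ in 𝓝[>] 0, ∀ V ∈ F, c ≤ c₀ V := by
      rw [Filter.eventually_all_finset]
      intro V hV
      filter_upwards [Ioc_mem_nhdsGT (hc₀ V hV)] with c hc using hc.2
    exact (h1.and self_mem_nhdsWithin).exists
  obtain ⟨r, ⟨hrle, hrδ, hrcube, hrdisj⟩, hr⟩ : ∃ r : ℝ, ((∀ V ∈ F, r ≤ r₀ V) ∧ r ≤ δ ∧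
      (∀ V ∈ F, Metric.ball V r ⊆ icoCube d) ∧
      (∀ V ∈ F, ∀ W ∈ F, V ≠ W → Disjoint (Metric.ball V r) (Metric.ball W r))) ∧ 0 < r := by
    have h1 : ∀ᶠ r : ℝ in 𝓝[>] 0, ∀ V ∈ F, r ≤ r₀ V := by
      rw [Filter.eventually_all_finset]
      intro V hV
      filter_upwards [Ioc_mem_nhdsGT (hr₀ V hV)] with c hc using hc.2
    have h2 : ∀ᶠ r : ℝ in 𝓝[>] 0, r ≤ δ := by
      filter_upwards [Ioc_mem_nhdsGT hδ] with c hc using hc.2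
    have h3 : ∀ᶠ r : ℝ in 𝓝[>] 0, ∀ V ∈ F, Metric.ball V r ⊆ icoCube d := by
      rw [Filter.eventually_all_finset]
      intro V hV
      obtain ⟨ε, hε, hsub⟩ := Metric.mem_nhds_iff.1 (hA.icoCube_mem_nhds ((hFmem V).1 hV))
      filter_upwards [Ioc_mem_nhdsGT hε] with c hc
      exact (Metric.ball_subset_ball hc.2).trans hsub
    have h4 : ∀ᶠ r : ℝ in 𝓝[>] 0, ∀ V ∈ F, ∀ W ∈ F, V ≠ W →
        Disjoint (Metric.ball V r) (Metric.ball W r) := by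
      rw [Filter.eventually_all_finset]
      intro V hV
      rw [Filter.eventually_all_finset]
      intro W hW
      by_cases hVW : V = W
      · exact .of_forall fun _ h => absurd hVW h
      · have hpos : 0 < dist V W / 2 := half_pos (dist_pos.2 hVW)
        filter_upwards [Ioc_mem_nhdsGT hpos] with c hc _
        exact Metric.ball_disjoint_ball (by linarith [hc.2])
    exact ((h1.and (h2.and (h3.and h4))).and self_mem_nhdsWithin).exists
  -- On the closed cube minus the balls, a compact set without maximum points, the supremum of `h`
  -- is attained and lies below `M`.
  obtain ⟨s₀, hs₀, htail⟩ : ∃ s₀ > 0, ∀ β ∈ angleCube d, (∀ V ∈ F, β ∉ Metric.ball V r) →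
      h β < ((M - s₀ : ℝ) : EReal) := by
    set K := angleCube d \ ⋃ V ∈ F, Metric.ball V r with hK
    have hKc : IsCompact K := (isCompact_univ_pi fun _ => isCompact_Icc).diff
      (isOpen_biUnion fun _ _ => Metric.isOpen_ball)
    have hmemK : ∀ β ∈ angleCube d, (∀ V ∈ F, β ∉ Metric.ball V r) → β ∈ K := fun β h1 h2 =>
      ⟨h1, by simpa using h2⟩
    rcases K.eq_empty_or_nonempty with he | hne
    · exact ⟨1, one_pos, fun β h1 h2 => absurd (hmemK β h1 h2) (by simp [he])⟩
    · obtain ⟨β₀, hβ₀, hβmax⟩ := hKc.exists_isMaxOn hne (hA.continuous.mono Set.sdiff_subset)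
      have hlt : h β₀ < M := by
        refine lt_of_le_of_ne (hA.le_max hβ₀.1) fun heq => hβ₀.2 ?_
        have hm : β₀ ∈ F := (hFmem _).2 ⟨hβ₀.1, heq⟩
        exact Set.mem_biUnion hm (Metric.mem_ball_self hr)
      obtain ⟨a, ha1, ha2⟩ := EReal.lt_iff_exists_real_btwn.1 hlt
      refine ⟨M - a, sub_pos.2 (by exact_mod_cast ha2), fun β h1 h2 => ?_⟩
      rw [sub_sub_cancel]
      exact lt_of_le_of_lt (hβmax (hmemK β h1 h2)) ha1
  have hdecomp : ∀ s ∈ Set.Ioo 0 s₀, superlevel h M s =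
      ⋃ V ∈ F, Metric.ball V r ∩ {β | g V - s ≤ g β} := by
    intro s hs
    ext β
    simp only [Set.mem_iUnion]
    constructor
    · rintro ⟨h1, h2⟩
      by_contra hcon
      push Not at hcon
      have hnot : ∀ V ∈ F, β ∉ Metric.ball V r := by
        intro V hV hβ
        refine hcon V hV ⟨hβ, ?_⟩
        rw [Set.mem_ofPred_eq, hgV V hV, ← EReal.coe_le_coe_iff,
          hcoe V hV β (Metric.ball_subset_ball hrδ hβ) h1]
        exact h2
      have h3 := htail β (icoCube_subset_angleCube d h1) hnot
      have h4 := h2.trans_lt h3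
      rw [EReal.coe_lt_coe_iff] at h4
      linarith [hs.2]
    · rintro ⟨V, hV, hβ, h2⟩
      have h1 := hrcube V hV hβ
      refine ⟨h1, ?_⟩
      rw [← hcoe V hV β (Metric.ball_subset_ball hrδ hβ) h1, EReal.coe_le_coe_iff, ← hgV V hV]
      exact h2
  have hev : ∀ᶠ s in 𝓝[>] (0 : ℝ), s ∈ Set.Ioo 0 s₀ := Ioo_mem_nhdsGT hs₀
  constructor
  · intro Φ hΦ
    have hsum := tendsto_finsetSum F fun V hV => hlim V hV r ⟨hr, hrle V hV⟩ Φ hΦ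
    rw [← Finset.mul_sum] at hsum
    refine hsum.congr' ?_
    filter_upwards [hev] with s hs
    rw [hdecomp s hs, ← Finset.mul_sum, integral_biUnion_finset]
    · exact fun V hV => measurableSet_ball_inter_le
        ((hcont V hV).mono (Metric.ball_subset_ball (hrle V hV))) _
    · intro V hV W hW hVW
      exact (hrdisj V hV W hW hVW).mono Set.inter_subset_left Set.inter_subset_left
    · intro V hV
      exact (hΦ.continuousOn.integrableOn_compact (isCompact_closedBall V r)).mono_set
        (Set.inter_subset_left.trans Metric.ball_subset_closedBall)
  -- From `c ‖β - V‖² ≤ s` with the smallest decay rate.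
  · refine ⟨√c⁻¹, by positivity, ?_⟩
    filter_upwards [hev] with s hs β hβ
    rw [hdecomp s hs] at hβ
    simp only [Set.mem_iUnion] at hβ
    obtain ⟨V, hV, hβ, h2⟩ := hβ
    refine ⟨V, (hFmem V).1 hV, ?_⟩
    have h3 := hdec V hV β (Metric.ball_subset_ball (hrle V hV) hβ)
    have h4 : c * ‖β - V‖ ^ 2 ≤ s := by
      rw [Set.mem_ofPred_eq] at h2
      have : c * ‖β - V‖ ^ 2 ≤ c₀ V * ‖β - V‖ ^ 2 := by gcongr; exact hcle V hV
      linarith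
    rw [← Real.sqrt_mul (by positivity)]
    refine Real.le_sqrt_of_sq_le ?_
    rw [inv_mul_eq_div, le_div_iff₀ hc]
    linarith

end Kernel

/-! ### Combining the two approximations. -/

section Assembly

/-- Positivity of `c` avoids `0 * ⊤`: for `H = ⊥` both sides fail, for `H = ⊤` both hold. -/
lemma ereal_mul_sub_le_iff {c : ℝ} (hc : 0 < c) (M t : ℝ) (H : EReal) :
    (c : EReal) * ((M : EReal) - H) ≤ t ↔ ((M - t / c : ℝ) : EReal) ≤ H := by
  induction H with
  | bot => simp [EReal.coe_mul_top_of_pos hc, EReal.coe_ne_bot, -EReal.coe_sub]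
  | top => simp [EReal.coe_mul_bot_of_pos hc]
  | coe x =>
    rw [← EReal.coe_sub, ← EReal.coe_mul, EReal.coe_le_coe_iff, EReal.coe_le_coe_iff,
      sub_le_comm, le_div_iff₀ hc, mul_comm]

lemma le_uMax_iff {m : ℕ} (f : (Fin m → Circle) → EReal) (x : ℕ → Circle) (n : ℕ) (a : ℝ) :
    (a : EReal) ≤ uMax f x n ↔ ∃ J : Fin m ↪o Fin n, (a : EReal) ≤ f fun k => x (J k) := by
  unfold uMax
  constructor
  · intro h
    rcases isEmpty_or_nonempty (Fin m ↪o Fin n) with he | hne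
    · rw [iSup_of_empty, le_bot_iff] at h
      exact absurd h (EReal.coe_ne_bot a)
    · have : Finite (Fin m ↪o Fin n) := Finite.of_injective (fun J => (J : Fin m → Fin n))
        DFunLike.coe_injective
      obtain ⟨J, hJ⟩ := exists_eq_ciSup_of_finite
        (f := fun J : Fin m ↪o Fin n => f fun k => x (J k))
      exact ⟨J, by rwa [hJ]⟩
  · rintro ⟨J, hJ⟩
    exact hJ.trans (le_iSup (fun J : Fin m ↪o Fin n => f fun k => x (J k)) J)

/-- Pairs of points whose central angle is within `ε` of a coordinate of a maximum point. -/
def nearPairs {d : ℕ} (h : (Fin d → ℝ) → EReal) (M ε : ℝ) : Set (Circle × Circle) :=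
  {z | ∃ V ∈ maxPoints h M, ∃ l, |circleAngle (z.2 / z.1) - V l| ≤ ε}

variable {d : ℕ} {f : (Fin (d + 1) → Circle) → EReal} {h : (Fin d → ℝ) → EReal} {M : ℝ}

lemma KernelConditions.measurableSet_nearPairs (hA : KernelConditions f h M) (ε : ℝ) :
    MeasurableSet (nearPairs h M ε) := by
  have hEq : nearPairs h M ε = ⋃ V ∈ maxPoints h M, ⋃ l,
      {z : Circle × Circle | |circleAngle (z.2 / z.1) - V l| ≤ ε} := by
    ext z; simp [nearPairs]
  rw [hEq]
  refine hA.finite_maxPoints.measurableSet_biUnion fun V _ => MeasurableSet.iUnion fun l => ?_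
  have hm : Measurable fun z : Circle × Circle => circleAngle (z.2 / z.1) :=
    measurable_circleAngle.comp (measurable_snd.div measurable_fst)
  exact measurableSet_le (continuous_abs.measurable.comp (hm.sub_const _)) measurable_const

/-- By symmetry point `i` can be swapped into the base position; point `j` then has one of the
central angles, all close to those of a maximum point. -/
lemma KernelConditions.mem_nearPairs (hA : KernelConditions f h M) {s ε : ℝ}
    (hs : ∀ β ∈ superlevel h M s, ∃ V ∈ maxPoints h M, ‖β - V‖ ≤ ε) {x : Fin (d + 1) → Circle}
    (hx : relAngles x ∈ superlevel h M s) {i j : Fin (d + 1)} (hij : i ≠ j) :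
    (x i, x j) ∈ nearPairs h M ε := by
  have h1 : relAngles (x ∘ Equiv.swap 0 i) ∈ superlevel h M s := by
    rw [← hA.le_iff_relAngles_mem, hA.symmetric, hA.le_iff_relAngles_mem]
    exact hx
  obtain ⟨V, hV, hVε⟩ := hs _ h1
  have hj : Equiv.swap 0 i j ≠ 0 := by
    intro h0
    rw [Equiv.swap_apply_eq_iff, Equiv.swap_apply_left] at h0
    exact hij h0.symm
  obtain ⟨k, hk⟩ := Fin.exists_succ_eq.2 hj
  refine ⟨V, hV, k, ?_⟩
  have h2 := (norm_le_pi_norm (relAngles (x ∘ Equiv.swap 0 i) - V) k).trans hVε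
  simpa [relAngles, hk] using h2

/-- Union bound over the coordinates of the finitely many maximum points, each contributing an angle
interval of length `2 ε`. -/
lemma KernelConditions.circleLaw_nearPairs_le (hA : KernelConditions f h M) {p : ℝ → ℝ}
    (hp : IsCircleDensity p) {C : ℝ} (hC0 : 0 ≤ C) (hC : ∀ x, p x ≤ C) {ε : ℝ} (hε : 0 ≤ ε)
    (u : Circle) : (circleLaw p).real {v | (u, v) ∈ nearPairs h M ε} ≤
      hA.finite_maxPoints.toFinset.card * d * (C * (2 * ε)) := by
  have hEq : {v | (u, v) ∈ nearPairs h M ε} = ⋃ V ∈ hA.finite_maxPoints.toFinset,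
      ⋃ l ∈ (Finset.univ : Finset (Fin d)),
        {v : Circle | circleAngle (v / u) ∈ Metric.closedBall (V l) ε} := by
    ext z; simp [nearPairs, Real.dist_eq]
  refine ENNReal.toReal_le_of_le_ofReal (by positivity) ?_
  rw [hEq]
  calc _ ≤ ∑ V ∈ hA.finite_maxPoints.toFinset, ∑ l ∈ (Finset.univ : Finset (Fin d)),
        circleLaw p {v : Circle | circleAngle (v / u) ∈ Metric.closedBall (V l) ε} :=
        (measure_biUnion_finset_le _ _).trans
          (Finset.sum_le_sum fun V _ => measure_biUnion_finset_le _ _)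
    _ ≤ ∑ V ∈ hA.finite_maxPoints.toFinset, ∑ l ∈ (Finset.univ : Finset (Fin d)),
        ENNReal.ofReal (C * (2 * ε)) := by
        refine Finset.sum_le_sum fun V _ => Finset.sum_le_sum fun l _ => ?_
        refine (circleLaw_angle_le hp hC u Metric.isClosed_closedBall.measurableSet).trans ?_
        rw [Real.volume_closedBall, ENNReal.ofReal_mul hC0]
    _ = _ := by
        simp only [Finset.sum_const, Finset.card_univ, Fintype.card_fin, nsmul_eq_mul]
        rw [mul_assoc, ENNReal.ofReal_mul (Nat.cast_nonneg _), ENNReal.ofReal_mul (p := (d : ℝ))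
          (Nat.cast_nonneg _), ENNReal.ofReal_natCast, ENNReal.ofReal_natCast]

lemma tendsto_choose_div_pow (m : ℕ) :
    Tendsto (fun n : ℕ => (n.choose m : ℝ) / (n : ℝ) ^ m) atTop (𝓝 (1 / m.factorial)) := by
  have h1 := isEquivalent_choose m
  have hz : ∀ᶠ n : ℕ in atTop, ((n : ℝ) ^ m / m.factorial) ≠ 0 := by
    filter_upwards [eventually_gt_atTop 0] with n hn
    have : (0 : ℝ) < n := by exact_mod_cast hn
    positivity
  have h2 := ((Asymptotics.isEquivalent_iff_tendsto_one hz).1 h1).mul_const (1 / (m.factorial : ℝ))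
  rw [one_mul] at h2
  refine h2.congr' ?_
  filter_upwards [eventually_gt_atTop 0] with n hn
  have : (0 : ℝ) < n := by exact_mod_cast hn
  have : (m.factorial : ℝ) ≠ 0 := by exact_mod_cast m.factorial_ne_zero
  simp only [Pi.div_apply]
  field_simp

/-- The expected number of `d + 1`-tuples with nearly maximal kernel value. -/
lemma KernelConditions.tendsto_choose_mul (hA : KernelConditions f h M) (hd : 1 ≤ d) {p : ℝ → ℝ}
    (hp : IsCircleDensity p) {t : ℝ} (ht : 0 < t) :
    Tendsto (fun n : ℕ => (n.choose (d + 1) : ℝ) *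
      (Measure.pi fun _ : Fin (d + 1) => circleLaw p).real
        {x | relAngles x ∈ superlevel h M (t / (n : ℝ) ^ (2 * ((d : ℝ) + 1) / (d : ℝ)))}) atTop
      (𝓝 (t ^ ((d : ℝ) / 2) * limitConstant p h M / ((d : ℝ) + 1))) := by
  have hd0 : (0 : ℝ) < d := by exact_mod_cast hd
  have hs : Tendsto (fun n : ℕ => t / (n : ℝ) ^ (2 * ((d : ℝ) + 1) / (d : ℝ))) atTop (𝓝[>] 0) := by
    rw [tendsto_nhdsWithin_iff]
    constructor
    · exact ((tendsto_rpow_atTop (by positivity)).comp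
        tendsto_natCast_atTop_atTop).const_div_atTop t
    · filter_upwards [eventually_gt_atTop 0] with n hn
      have : (0 : ℝ) < n := by exact_mod_cast hn
      exact div_pos ht (by positivity)
  have h1 := ((hA.tendsto_superlevel hd).1 _ (continuous_configIntegral hp)).comp hs
  have hsum := hA.sum_maxPoints (fun V => 1 / √(-hessianMatrix (fun x => (h x).toReal) V).det *
    configIntegral p V) (fun V hV σ => by
      rw [hA.det_hessianMatrix_comp_perm σ hV, configIntegral_comp_perm])
  rw [hsum] at h1
  have h2 := ((tendsto_choose_div_pow (d + 1)).mul_const (t ^ ((d : ℝ) / 2))).mul h1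
  have hconst : 1 / ((d + 1).factorial : ℝ) * t ^ ((d : ℝ) / 2) *
      ((2 * Real.pi) ^ ((d : ℝ) / 2) / Real.Gamma (((d : ℝ) + 2) / 2) * ((d.factorial : ℝ) *
        ∑ᶠ W ∈ orderedMaxPoints h M, 1 / √(-hessianMatrix (fun x => (h x).toReal) W).det *
          configIntegral p W)) = t ^ ((d : ℝ) / 2) * limitConstant p h M / ((d : ℝ) + 1) := by
    have hf : (d.factorial : ℝ) ≠ 0 := by exact_mod_cast d.factorial_ne_zero
    rw [limitConstant, Nat.factorial_succ]
    push_cast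
    field_simp
  rw [hconst] at h2
  refine h2.congr' ?_
  filter_upwards [eventually_gt_atTop 0] with n hn
  have hn' : (0 : ℝ) < n := by exact_mod_cast hn
  rw [pi_circleLaw_relAngles hp (hA.measurableSet_superlevel _) fun β hβ => hβ.1]
  simp only [Function.comp]
  -- Here `(t / n ^ (2(d+1)/d)) ^ (-d/2) = t ^ (-d/2) n ^ (d+1)`, which cancels the normalisation of
  -- the binomial coefficient.
  rw [Real.div_rpow ht.le (by positivity), ← Real.rpow_mul hn'.le, Real.rpow_neg ht.le,
    show 2 * ((d : ℝ) + 1) / d * -(d / 2) = -((d + 1 : ℕ) : ℝ) by push_cast; field_simp,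
    Real.rpow_neg hn'.le, Real.rpow_natCast]
  have : t ^ ((d : ℝ) / 2) ≠ 0 := (Real.rpow_pos_of_pos ht _).ne'
  field_simp

end Assembly

/-- The degree of the kernel is `m = d + 1 ≥ 2`. -/
theorem corollary4p3 {Ω : Type*} [MeasurableSpace Ω] (μ : Measure Ω) [IsProbabilityMeasure μ]
    (d : ℕ) (hd : 1 ≤ d) (f : (Fin (d + 1) → Circle) → EReal) (h : (Fin d → ℝ) → EReal) (M : ℝ)
    (U : ℕ → Ω → Circle) (p : ℝ → ℝ)
    (hA : KernelConditions f h M) (hB : PointConditions μ U p h M)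
    (t : ℝ) (ht : 0 < t) :
    Tendsto
      (fun n : ℕ => μ.real {ω |
        (((n : ℝ) ^ (2 * ((d : ℝ) + 1) / (d : ℝ)) : ℝ) : EReal) *
          ((M : EReal) - uMax f (fun i => U i ω) n) ≤ (t : EReal)})
      atTop
      (𝓝 (1 - Real.exp (-(t ^ ((d : ℝ) / 2) * limitConstant p h M / ((d : ℝ) + 1))))) := by
  have hp := hB.density
  have hν := isProbabilityMeasure_circleLaw hp
  have hd0 : (0 : ℝ) < d := by exact_mod_cast hd
  set s : ℕ → ℝ := fun n => t / (n : ℝ) ^ (2 * ((d : ℝ) + 1) / (d : ℝ)) with hs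
  set A : ℕ → Set (Fin (d + 1) → Circle) := fun n => {x | relAngles x ∈ superlevel h M (s n)}
    with hAdef
  have hAm : ∀ n, MeasurableSet (A n) := fun n =>
    (hA.measurableSet_superlevel _).preimage measurable_relAngles
  set P : ℕ → Set Ω := fun n => {ω | ∀ J : Fin (d + 1) ↪o Fin n, (fun k => U (J k) ω) ∉ A n}
    with hP
  have hPm : ∀ n, MeasurableSet (P n) := by
    intro n
    have : Countable (Fin (d + 1) ↪o Fin n) := (DFunLike.coe_injective).countable
    rw [hP]
    simp only [Set.ofPred_forall]
    exact MeasurableSet.iInter fun J =>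
      ((hAm n).preimage (measurable_pi_lambda _ fun k => hB.measurable (J k))).compl
  -- `n = 0` is left out because the scaling factor must be positive.
  have hcompl : ∀ᶠ n : ℕ in atTop, 1 - μ.real (P n) = μ.real {ω |
        (((n : ℝ) ^ (2 * ((d : ℝ) + 1) / (d : ℝ)) : ℝ) : EReal) *
          ((M : EReal) - uMax f (fun i => U i ω) n) ≤ (t : EReal)} := by
    filter_upwards [eventually_gt_atTop 0] with n hn
    have hn' : (0 : ℝ) < n := by exact_mod_cast hn
    rw [← probReal_compl_eq_one_sub (hPm n)]
    congr 1
    ext ω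
    rw [Set.mem_ofPred_eq, ereal_mul_sub_le_iff (by positivity), le_uMax_iff]
    simp only [hP, Set.mem_compl_iff, Set.mem_ofPred_eq, not_forall, not_not, hAdef,
      hA.le_iff_relAngles_mem, hs]
  suffices hmain : Tendsto (fun n => μ.real (P n)) atTop
      (𝓝 (Real.exp (-(t ^ ((d : ℝ) / 2) * limitConstant p h M / ((d : ℝ) + 1))))) from
    (hmain.const_sub 1).congr' hcompl
  have hlim := (Real.continuous_exp.tendsto _).comp (hA.tendsto_choose_mul hd hp ht).neg
  obtain ⟨C, hC, hconc⟩ := (hA.tendsto_superlevel hd).2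
  obtain ⟨D, hD, hDp⟩ := hp.exists_bound
  set c : ℝ := hA.finite_maxPoints.toFinset.card * d * (D * (2 * (C * √t))) with hc
  have hc0 : 0 ≤ c := by positivity
  have hsn : Tendsto s atTop (𝓝[>] 0) := by
    rw [tendsto_nhdsWithin_iff]
    constructor
    · exact ((tendsto_rpow_atTop (by positivity)).comp
        tendsto_natCast_atTop_atTop).const_div_atTop t
    · filter_upwards [eventually_gt_atTop 0] with n hn
      have : (0 : ℝ) < n := by exact_mod_cast hn
      exact div_pos ht (by positivity)
  have hz : Tendsto (fun n : ℕ => (n : ℝ) ^ (-(1 / (d : ℝ)))) atTop (𝓝 0) :=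
    (tendsto_rpow_neg_atTop (by positivity)).comp tendsto_natCast_atTop_atTop
  -- As `√(s n) = √t n ^ (-(d+1)/d)`, one gets `n q = c n ^ (-1/d)`, hence `n (n q) ^ (d+1) = c ^
  -- (d+1) n ^ (-1/d)`.
  have hbound : ∀ᶠ n : ℕ in atTop, |μ.real (P n) - Real.exp (-((n.choose (d + 1) : ℝ) *
      (Measure.pi fun _ : Fin (d + 1) => circleLaw p).real (A n)))| ≤
      2 * ((2 * (d + 1 : ℕ) + 1) * 16 ^ (d + 1)) * c ^ (d + 1) * (n : ℝ) ^ (-(1 / (d : ℝ))) := by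
    have hcz := hz.const_mul c
    rw [mul_zero] at hcz
    filter_upwards [eventually_gt_atTop 0, hsn.eventually hconc,
      hcz.eventually (ge_mem_nhds one_pos)] with n hn hnear hle
    have hn' : (0 : ℝ) < n := by exact_mod_cast hn
    set q : ℝ := hA.finite_maxPoints.toFinset.card * d * (D * (2 * (C * √(s n)))) with hq
    have hsqrt : √(s n) = √t * (n : ℝ) ^ (-(((d : ℝ) + 1) / d)) := by
      rw [hs]
      dsimp only
      rw [Real.sqrt_div ht.le, Real.sqrt_eq_rpow ((n : ℝ) ^ _), ← Real.rpow_mul hn'.le,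
        div_eq_mul_inv, ← Real.rpow_neg hn'.le]
      congr 2
      field_simp
    have hnq : n * q = c * (n : ℝ) ^ (-(1 / (d : ℝ))) := by
      have : (n : ℝ) ^ (-(1 / (d : ℝ))) = n * (n : ℝ) ^ (-(((d : ℝ) + 1) / d)) := by
        nth_rewrite 2 [← Real.rpow_one (n : ℝ)]
        rw [← Real.rpow_add hn']
        congr 1
        field_simp
        ring
      rw [hq, hsqrt, this, hc]
      ring
    have hmain := abs_measureReal_forall_notMem_sub_exp_le (μ := μ) (ν := circleLaw p) hn
      (show 2 ≤ d + 1 by omega) (U := fun i : Fin n => U i) (fun i => hB.measurable i)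
      (hB.independent.precomp Fin.val_injective) (fun i => hB.law i) (hAm n)
      (hA.measurableSet_nearPairs (C * √(s n)))
      (fun x hx i j hij => hA.mem_nearPairs hnear hx hij) (q := q) (by positivity)
      (fun u => hA.circleLaw_nearPairs_le hp hD.le hDp (by positivity) u) (by rw [hnq]; exact hle)
    refine hmain.trans_eq ?_
    rw [hnq, mul_pow, ← Real.rpow_natCast ((n : ℝ) ^ (-(1 / (d : ℝ)))) (d + 1),
      ← Real.rpow_mul hn'.le]
    have : (n : ℝ) ^ (-(1 / (d : ℝ))) = n * (n : ℝ) ^ (-(1 / (d : ℝ)) * ((d + 1 : ℕ) : ℝ)) := by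
      nth_rewrite 2 [← Real.rpow_one (n : ℝ)]
      rw [← Real.rpow_add hn']
      congr 1
      push_cast
      field_simp
      ring
    rw [this]
    ring
  have hz' := hz.const_mul (2 * ((2 * (d + 1 : ℕ) + 1) * 16 ^ (d + 1)) * c ^ (d + 1))
  rw [mul_zero] at hz'
  have hdiff := squeeze_zero_norm' (f := fun n : ℕ => μ.real (P n) -
    Real.exp (-((n.choose (d + 1) : ℝ) *
      (Measure.pi fun _ : Fin (d + 1) => circleLaw p).real (A n)))) hbound hz'
  have := hdiff.add hlim
  rw [zero_add] at this
  refine this.congr fun n => ?_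
  simp only [Function.comp]
  ring
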